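/- Let $n\ge 1$ and consider $\mathbb{R}^n$ with the Euclidean distance and Lebesgue measure; put $V(y,t)=|B(y,t)|$ and let $L^0(\mathbb{R}^{n+1}_+)$ be the space of measurable complex-valued functions on $\mathbb{R}^{n+1}_+=\mathbb{R}^n\times(0,\infty)$ modulo equality almost everywhere. For $p,q\in(0,\infty)$ and $s\in\mathbb{R}$, the weighted tent space $T^{p,q}_s(\mathbb{R}^n)$ consists of all $f\in L^0(\mathbb{R}^{n+1}_+)$ with $$\|f\|_{T^{p,q}_s}:=\left(\int_{\mathbb{R}^n}\left(\iint_{\{(y,t)\,:\,|y-x|<t\}}|V(y,t)^{-s}f(y,t)|^q\,\frac{dy}{V(y,t)}\,\frac{dt}{t}\right)^{p/q}dx\right)^{1/p}<\infty .$$ For $c_0\in(0,\infty)$ and $c_1\in(1,\infty)$ let $\Omega_{c_0,c_1}(x,t)=B(x,c_0t)\times(c_1^{-1}t,c_1t)$. The space $Z^{p,q}_s(\mathbb{R}^n;c_0,c_1)$ consists of all $f\in L^0(\mathbb{R}^{n+1}_+)$ with $$\|f\|_{Z^{p,q}_s(\mathbb{R}^n;c_0,c_1)}:=\left(\int_0^\infty\!\int_{\mathbb{R}^n}\left(\frac{1}{|\Omega_{c_0,c_1}(x,t)|}\iint_{\Omega_{c_0,c_1}(x,t)}|V(\xi,\tau)^{-s}f(\xi,\tau)|^q\,d\xi\,d\tau\right)^{p/q}dx\,\frac{dt}{t}\right)^{1/p}<\infty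 .$$ For two such spaces $A_0,A_1\subset L^0(\mathbb{R}^{n+1}_+)$ and $\theta\in(0,1)$, $r\in(0,\infty)$, the real interpolation space $(A_0,A_1)_{\theta,r}$ is the set of $f\in A_0+A_1$ with $\|f\|_{(A_0,A_1)_{\theta,r}}:=\left(\int_0^\infty\big(t^{-\theta}K(t,f)\big)^r\,\frac{dt}{t}\right)^{1/r}<\infty$, where $K(t,f)=\inf\{\|f_0\|_{A_0}+t\|f_1\|_{A_1}: f=f_0+f_1,\ f_j\in A_j\}$. **Theorem.** Suppose that $p_0,p_1\in(0,\infty)$, $q\in[1,\infty)$, $s_0\neq s_1\in\mathbb{R}$ and $\theta\in(0,1)$. Then for any $c_0\in(0,\infty)$ and $c_1\in(1,\infty)$ we have $$\left(T^{p_0,q}_{s_0}(\mathbb{R}^n),T^{p_1,q}_{s_1}(\mathbb{R}^n)\right)_{\theta,p_\theta}=Z^{p_\theta,q}_{s_\theta}(\mathbb{R}^n;c_0,c_1)$$ with equivalent quasi-norms, where $p_\theta^{-1}=(1-\theta)p_0^{-1}+\theta p_1^{-1}$ and $s_\theta=(1-\theta)s_0+\theta s_1$. -/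

import Mathlib

open MeasureTheory Set
open scoped ENNReal NNReal

noncomputable section

namespace TentSpaces

/-! ### The real interpolation method (K-method)

A quasi-normed abelian group continuously placed inside an ambient commutative group `A` is
encoded by its extended quasi-norm `N : A → ℝ≥0∞`; the group itself is `{a | N a < ∞}`. -/

section RealInterpolation

variable {A : Type*} [AddCommGroup A]

/-- The measure `dt / t` on `(0, ∞)`, as a measure on `ℝ` that vanishes on `(-∞, 0]`. -/
def dtOverT : Measure ℝ :=
  (volume.restrict (Ioi (0 : ℝ))).withDensity (fun t => ENNReal.ofReal t⁻¹)

/-- The subset of `A` on which an extended quasi-norm is finite. -/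
def finiteSpace (N : A → ℝ≥0∞) : Set A := {a | N a < ∞}

/-- The sum `A₀ + A₁` inside `A`. -/
def sumSpace (N₀ N₁ : A → ℝ≥0∞) : Set A :=
  {a | ∃ a₀ ∈ finiteSpace N₀, ∃ a₁ ∈ finiteSpace N₁, a = a₀ + a₁}

/-- Peetre's functional `K(t, a; A₀, A₁) = inf {‖a₀‖ + t ‖a₁‖ : a = a₀ + a₁, aⱼ ∈ Aⱼ}`; it is `∞`
if `a` is not in `A₀ + A₁`. -/
def KFunctional (N₀ N₁ : A → ℝ≥0∞) (t : ℝ) (a : A) : ℝ≥0∞ :=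
  ⨅ (a₀ ∈ finiteSpace N₀) (a₁ ∈ finiteSpace N₁) (_ : a = a₀ + a₁),
    N₀ a₀ + ENNReal.ofReal t * N₁ a₁

/-- The real interpolation quasi-norm
`‖a‖_{θ,r} = (∫_0^∞ (t^{-θ} K(t, a))^r dt / t)^{1/r}` for finite `r`. -/
def interpNorm (N₀ N₁ : A → ℝ≥0∞) (θ r : ℝ) (a : A) : ℝ≥0∞ :=
  (∫⁻ t, (ENNReal.ofReal (t ^ (-θ)) * KFunctional N₀ N₁ t a) ^ r ∂dtOverT) ^ (1 / r)

/-- The real interpolation space `(A₀, A₁)_{θ,r}`. -/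
def interpSpace (N₀ N₁ : A → ℝ≥0∞) (θ r : ℝ) : Set A :=
  {a | a ∈ sumSpace N₀ N₁ ∧ interpNorm N₀ N₁ θ r a < ∞}

end RealInterpolation

/-! ### Weighted tent spaces and Z-spaces on a metric measure space

The upper half-space `X⁺ = X × (0, ∞)` is realised inside `X × ℝ`: the measure `dμ(y) dt / t`
gives no mass to the points `(y, t)` with `t ≤ 0`. -/

section Spaces

variable (X : Type*) [MetricSpace X] [MeasureSpace X]

/-- The measure `dμ(y) dt / t` on the upper half-space. -/
def halfSpaceMeasure : Measure (X × ℝ) := (volume : Measure X).prod dtOverT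

/-- `L⁰(X⁺)`: measurable complex functions on the upper half-space modulo equality a.e. -/
abbrev L0 : Type _ := (X × ℝ) →ₘ[halfSpaceMeasure X] ℂ

variable {X}

/-- The cone `Γ(x) = {(y, t) : t > 0, y ∈ B(x, t)}`. -/
def cone (x : X) : Set (X × ℝ) := {z | 0 < z.2 ∧ z.1 ∈ Metric.ball x z.2}

/-- The operator `(V^s f)(y, t) = V(y, t)^s f(y, t)`, where `V(y, t)` is the volume of `B(y, t)`. -/
def volWeight (s : ℝ) (f : X × ℝ → ℂ) : X × ℝ → ℂ :=
  fun z => ((((volume (Metric.ball z.1 z.2)).toReal ^ s : ℝ)) : ℂ) * f z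

/-- The Lusin functional
`A^q f(x) = (∬_{Γ(x)} |f(y, t)|^q dμ(y) / V(y, t) dt / t)^{1/q}`. -/
def lusin (q : ℝ) (f : X × ℝ → ℂ) (x : X) : ℝ≥0∞ :=
  (∫⁻ z in cone x, ‖f z‖ₑ ^ q / volume (Metric.ball z.1 z.2) ∂(halfSpaceMeasure X)) ^ (1 / q)

/-- The quasi-norm of the weighted tent space `T^{p,q}_s(X)`, `‖A^q (V^{-s} f)‖_{L^p(X)}`. -/
def tentNorm (p q s : ℝ) (f : L0 X) : ℝ≥0∞ :=
  (∫⁻ x : X, lusin q (volWeight (-s) f) x ^ p) ^ (1 / p)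

/-- The weighted tent space `T^{p,q}_s(X)`. -/
def tentSpace (X : Type*) [MetricSpace X] [MeasureSpace X] (p q s : ℝ) : Set (L0 X) :=
  finiteSpace (tentNorm p q s)

/-- The Whitney region `B(x, c₀ t) × (c₁⁻¹ t, c₁ t)`. -/
def whitneyRegion (c₀ c₁ : ℝ) (x : X) (t : ℝ) : Set (X × ℝ) :=
  Metric.ball x (c₀ * t) ×ˢ Ioo (c₁⁻¹ * t) (c₁ * t)

/-- The `L^q` Whitney average; the mean is with respect to `dμ(ξ) dτ`. -/
def whitneyAverage (q c₀ c₁ : ℝ) (f : X × ℝ → ℂ) (z : X × ℝ) : ℝ≥0∞ :=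
  (⨍⁻ w in whitneyRegion c₀ c₁ z.1 z.2, ‖f w‖ₑ ^ q
    ∂((volume : Measure X).prod (volume : Measure ℝ))) ^ (1 / q)

/-- The quasi-norm of `Z^{p,q}_s(X; c₀, c₁)`, the `L^p(X⁺)` quasi-norm of the `L^q` Whitney
averages of `V^{-s} f`. -/
def zNorm (p q s c₀ c₁ : ℝ) (f : L0 X) : ℝ≥0∞ :=
  (∫⁻ z, whitneyAverage q c₀ c₁ (volWeight (-s) f) z ^ p ∂(halfSpaceMeasure X)) ^ (1 / p)

/-- The space `Z^{p,q}_s(X; c₀, c₁)`. -/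
def zSpace (X : Type*) [MetricSpace X] [MeasureSpace X] (p q s c₀ c₁ : ℝ) : Set (L0 X) :=
  finiteSpace (zNorm p q s c₀ c₁)

end Spaces

end TentSpaces

end

/-! Cut the half-space into boxes, cubes of side `ε e^{τk}` times levels `[e^{τk}, e^{τ(k+1)})`, and
let `m_k(x)` be the normalised `L^q` mean of `f` on the box at level `k` above `x`. The `p`-th power
of the Z quasi-norm is equivalent to `∑_k ∫ (e^{-snτk} m_k)^p` (`exists_boxSum_le_zNorm`,
`exists_zNorm_rpow_le_boxSum`). A tent quasi-norm is only sandwiched: it dominates the `L^p` norm of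
the supremum over `k` of the weighted means (`exists_lintegral_iSup_le_tentNorm`) and is dominated
by finitely many lattice translates of their `L^p(ℓ^q)` norm (`exists_tentNorm_rpow_le`). Because
`s₀ ≠ s₁`, the ratio of the two weights is geometric in `k`, and interpolation does not see this
gap.

From interpolation to Z (`exists_boxSum_le_interpNorm`): near-optimal decompositions for `K(e^{σj},
f)` bound the weighted `m_k(x)`, for every `j`, by a two-term expression.
`exists_tsum_rpow_le_of_balance` picks `j`, depending on `k` and `x`, so that the two terms balance.
Replacing the normalised suprema by a slowly varying majorant makes `k ↦ j` injective, so the sum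
over `k` is dominated by a sum over `j`; integrating in `x` leaves the discretised interpolation
norm.

From Z to interpolation (`exists_interpNorm_le_boxSum`): for each integer `i` put into `f₀` the
boxes with `(e^{κ₀k} m_k)^{p₀} ≤ e^i (e^{κ₁k} m_k)^{p₁}`, where `κ_ν = -s_ν n τ`, and the others
into `f₁`. By `exists_tsum_cutoff_le` and its two consequences, `∑_i (e^{-ηi} ‖f₀‖^{p₀} + e^{(1-η)i}
‖f₁‖^{p₁})` is bounded by the box sum. The balancing lemma, now applied to the K-functional itself,
converts this into the interpolation norm.

The sequence estimates are pointwise in `x` and assume no relation between different scales, so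
translating each scale separately is harmless and no maximal function or change of aperture is
needed. -/

namespace TentSpaces

/-! ### Exponentials in `ℝ≥0∞` and elementary sums. -/

/-- The exponential with values in `ℝ≥0∞`. -/
noncomputable def ex (x : ℝ) : ℝ≥0∞ := ENNReal.ofReal (Real.exp x)

theorem ex_add (x y : ℝ) : ex (x + y) = ex x * ex y := by
  rw [ex, Real.exp_add, ENNReal.ofReal_mul (Real.exp_pos x).le]; rfl

theorem ex_zero : ex 0 = 1 := by simp [ex]

theorem ex_pos (x : ℝ) : 0 < ex x := ENNReal.ofReal_pos.2 (Real.exp_pos x)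

theorem ex_ne_zero (x : ℝ) : ex x ≠ 0 := (ex_pos x).ne'

theorem ex_ne_top (x : ℝ) : ex x ≠ ∞ := ENNReal.ofReal_ne_top

theorem ex_mono {x y : ℝ} (h : x ≤ y) : ex x ≤ ex y :=
  ENNReal.ofReal_le_ofReal (Real.exp_le_exp.2 h)

theorem ex_le_ex {x y : ℝ} : ex x ≤ ex y ↔ x ≤ y := by
  rw [ex, ex, ENNReal.ofReal_le_ofReal_iff (Real.exp_pos y).le, Real.exp_le_exp]

theorem ex_rpow (x r : ℝ) : ex x ^ r = ex (x * r) := by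
  rw [ex, ENNReal.ofReal_rpow_of_pos (Real.exp_pos x), ← Real.exp_mul]; rfl

theorem ex_mul_ex_neg (x : ℝ) : ex x * ex (-x) = 1 := by
  rw [← ex_add, add_neg_cancel, ex_zero]

theorem ex_inv (x : ℝ) : (ex x)⁻¹ = ex (-x) :=
  (ENNReal.eq_inv_of_mul_eq_one_left (by rw [mul_comm]; exact ex_mul_ex_neg x)).symm

theorem exists_ex_eq {a : ℝ≥0∞} (h0 : a ≠ 0) (ht : a ≠ ∞) : ∃ x, a = ex x :=
  ⟨Real.log a.toReal, by
    rw [ex, Real.exp_log (ENNReal.toReal_pos h0 ht), ENNReal.ofReal_toReal ht]⟩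

theorem le_mul_ex_of_mul_ex_neg_le {a b : ℝ≥0∞} {x : ℝ} (h : ex (-x) * a ≤ b) : a ≤ ex x * b := by
  calc a = ex x * (ex (-x) * a) := by rw [← mul_assoc, ex_mul_ex_neg, one_mul]
    _ ≤ _ := by gcongr

theorem tsum_ex_neg_abs_lt_top {c : ℝ} (hc : 0 < c) : ∑' i : ℤ, ex (-(c * |(i : ℝ)|)) < ∞ := by
  have h1 : ∀ i : ℕ, Real.exp (-(c * i)) = Real.exp (-c) ^ i := by
    intro i; rw [← Real.exp_nat_mul]; ring_nf
  have hs : Summable (fun i : ℕ => Real.exp (-(c * i))) := by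
    simp_rw [h1]
    exact summable_geometric_of_lt_one (Real.exp_pos _).le (Real.exp_lt_one_iff.2 (by linarith))
  have h : Summable (fun i : ℤ => Real.exp (-(c * |(i : ℝ)|))) := by
    apply Summable.of_nat_of_neg
    · simpa using hs
    · simpa using hs
  have := ENNReal.ofReal_tsum_of_nonneg (fun i : ℤ => (Real.exp_pos (-(c * |(i : ℝ)|))).le) h
  rw [show (∑' i : ℤ, ex (-(c * |(i : ℝ)|))) = _ from this.symm]
  exact ENNReal.ofReal_lt_top

/-- Sums of two-sided exponentials over an arithmetic progression, uniformly in the offset. -/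
theorem exists_tsum_ex_neg_abs_le {c α : ℝ} (hc : 0 < c) (hα : α ≠ 0) :
    ∃ C : ℝ≥0, ∀ b : ℝ, ∑' i : ℤ, ex (-(c * |α * i + b|)) ≤ C := by
  set c' := c * |α| with hc'
  have hc'0 : 0 < c' := mul_pos hc (abs_pos.2 hα)
  have hfin : ex c' * ∑' i : ℤ, ex (-(c' * |(i : ℝ)|)) ≠ ∞ :=
    ENNReal.mul_ne_top (ex_ne_top _) (tsum_ex_neg_abs_lt_top hc'0).ne
  refine ⟨(ex c' * ∑' i : ℤ, ex (-(c' * |(i : ℝ)|))).toNNReal, fun b => ?_⟩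
  -- Shifting the index by `⌊b / α⌋` leaves an offset in `[0, 1)`, which costs at most the factor
  -- `ex c'`.
  rw [ENNReal.coe_toNNReal hfin, ← ENNReal.tsum_mul_left,
    ← (Equiv.subRight ⌊b / α⌋).tsum_eq (fun i : ℤ => ex (-(c * |α * i + b|)))]
  refine ENNReal.tsum_le_tsum fun i => ?_
  rw [← ex_add]
  apply ex_mono
  have h1 : α * ((Equiv.subRight ⌊b / α⌋ i : ℤ) : ℝ) + b = α * (i + Int.fract (b / α)) := by
    simp only [Equiv.subRight_apply, Int.cast_sub, Int.fract]
    field_simp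
    ring
  rw [h1, abs_mul]
  have h2 : |(i : ℝ)| ≤ |(i : ℝ) + Int.fract (b / α)| + 1 := by
    have := abs_sub_abs_le_abs_sub (i : ℝ) (-(Int.fract (b/α)))
    rw [abs_neg, abs_of_nonneg (Int.fract_nonneg (b/α)), sub_neg_eq_add] at this
    linarith [Int.fract_lt_one (b / α)]
  have := mul_le_mul_of_nonneg_left h2 hc'0.le
  rw [hc'] at this ⊢
  nlinarith

/-- Comparing every term with the largest one treats `r < 1` and `r ≥ 1` together, without
convexity. -/
theorem sum_rpow_le_card_mul {ι : Type*} (s : Finset ι) (x : ι → ℝ≥0∞) {r : ℝ} (hr : 0 < r) :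
    (∑ i ∈ s, x i) ^ r ≤ (s.card : ℝ≥0∞) ^ r * ∑ i ∈ s, x i ^ r := by
  rcases s.eq_empty_or_nonempty with rfl | hs
  · simp [hr]
  obtain ⟨j, hj, hmax⟩ := s.exists_max_image x hs
  calc (∑ i ∈ s, x i) ^ r ≤ (s.card * x j) ^ r := by
        gcongr
        simpa using Finset.sum_le_card_nsmul s x (x j) hmax
    _ = (s.card : ℝ≥0∞) ^ r * x j ^ r := ENNReal.mul_rpow_of_nonneg _ _ hr.le
    _ ≤ _ := by
        gcongr
        exact Finset.single_le_sum (f := fun i => x i ^ r) (fun _ _ => zero_le) hj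

theorem add_rpow_le_two_mul (x y : ℝ≥0∞) {r : ℝ} (hr : 0 < r) :
    (x + y) ^ r ≤ (2 : ℝ≥0∞) ^ r * (x ^ r + y ^ r) := by
  simpa [Fin.sum_univ_two] using sum_rpow_le_card_mul Finset.univ ![x, y] hr

/-! ### Slowly varying majorants and balancing of two terms. -/

/-- The exponential smoothing of a sequence, which varies slowly. -/
noncomputable def smoothing (ε : ℝ) (γ : ℤ → ℝ≥0∞) (j : ℤ) : ℝ≥0∞ :=
  ∑' i : ℤ, ex (-(ε * |((i : ℝ) - j)|)) * γ i

theorem le_smoothing (ε : ℝ) (γ : ℤ → ℝ≥0∞) (j : ℤ) : γ j ≤ smoothing ε γ j := by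
  have := ENNReal.le_tsum (f := fun i : ℤ => ex (-(ε * |((i : ℝ) - j)|)) * γ i) j
  simpa [ex_zero, smoothing] using this

/-- The triangle inequality in the exponent. For neighbouring indices it says that the logarithm of
the smoothing moves by at most `ε`, which is the slow variation used in balancing. -/
theorem smoothing_le {ε : ℝ} (hε : 0 ≤ ε) (γ : ℤ → ℝ≥0∞) (j l : ℤ) :
    smoothing ε γ j ≤ ex (ε * |((j : ℝ) - l)|) * smoothing ε γ l := by
  rw [smoothing, smoothing, ← ENNReal.tsum_mul_left]
  refine ENNReal.tsum_le_tsum fun i => ?_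
  rw [← mul_assoc, ← ex_add]
  gcongr
  apply ex_mono
  have := abs_sub_le (i : ℝ) j l
  nlinarith

theorem exists_tsum_smoothing_le {ε : ℝ} (hε : 0 < ε) :
    ∃ C : ℝ≥0, ∀ γ : ℤ → ℝ≥0∞, ∑' j, smoothing ε γ j ≤ C * ∑' i, γ i := by
  obtain ⟨C, hC⟩ := exists_tsum_ex_neg_abs_le hε (α := -1) (by norm_num)
  refine ⟨C, fun γ => ?_⟩
  simp_rw [smoothing]
  rw [ENNReal.tsum_comm, ← ENNReal.tsum_mul_left]
  refine ENNReal.tsum_le_tsum fun i => ?_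
  rw [ENNReal.tsum_mul_right]
  gcongr
  refine le_trans (le_of_eq ?_) (hC i)
  congr 1; ext j; ring_nf

/-- A real sequence with steps in `[σ/2, 3σ/2]` comes within `3σ/2` of every real number. -/
theorem exists_index_of_steps {h : ℤ → ℝ} {σ : ℝ} (hσ : 0 < σ)
    (h1 : ∀ j, σ / 2 ≤ h (j + 1) - h j) (h2 : ∀ j, h (j + 1) - h j ≤ 3 * σ / 2) (y : ℝ) :
    ∃ j, h j ≤ y ∧ y ≤ h j + 3 * σ / 2 := by
  have hpos : ∀ m : ℕ, ∀ j, h j + m * (σ / 2) ≤ h (j + m) := by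
    intro m
    induction m with
    | zero => intro j; simp
    | succ m ih =>
      intro j
      have a := ih j
      have b := h1 (j + m)
      push_cast
      rw [← add_assoc]
      linarith
  have hmono : ∀ i j, i ≤ j → h i + ((j : ℝ) - i) * (σ / 2) ≤ h j := by
    intro i j hij
    obtain ⟨m, rfl⟩ := Int.le.dest hij
    simpa using hpos m i
  obtain ⟨N, hN⟩ := exists_nat_gt (|y - h 0| / (σ / 2))
  rw [div_lt_iff₀ (by positivity)] at hN
  have hb : ∀ z : ℤ, h z ≤ y → z ≤ N := by
    intro z hz
    by_contra hlt
    push Not at hlt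
    have a := hmono 0 z (by omega)
    have b : (N : ℝ) ≤ z := by exact_mod_cast hlt.le
    have := le_abs_self (y - h 0)
    push_cast at a
    nlinarith
  have hn : ∃ z : ℤ, h z ≤ y := by
    refine ⟨-N, ?_⟩
    have a := hmono (-N) 0 (by omega)
    have := neg_abs_le (y - h 0)
    push_cast at a
    linarith
  obtain ⟨j, hj, hmax⟩ := Int.exists_greatest_of_bdd ⟨N, hb⟩ hn
  refine ⟨j, hj, ?_⟩
  by_contra hlt
  push Not at hlt
  have := hmax (j + 1) (by linarith [h2 j])
  omega

/-- If a sequence `c` is dominated, for every `j`, by a two-term expression with parameter `j`,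
then choosing `j` so that the two terms balance bounds the `ℓ^p` norm of `c`. -/
theorem exists_tsum_rpow_le_of_balance {p₀ p₁ θ p κ σ : ℝ} (hp₀ : 0 < p₀) (hp₁ : 0 < p₁)
    (hθ₀ : 0 < θ) (hθ₁ : θ < 1) (hp : p⁻¹ = (1 - θ) * p₀⁻¹ + θ * p₁⁻¹) (hσ : 0 < σ)
    (hκ : 2 * σ ≤ |κ|) :
    ∃ C : ℝ≥0, ∃ ε : ℝ, 0 < ε ∧ ∀ c l γ : ℤ → ℝ≥0∞, (∀ j, l j ≠ 0) →
      (∀ k j : ℤ, c k ≤ l j * (ex (θ * (κ * k + σ * j)) * γ j ^ (1 / p₀) +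
        ex (-((1 - θ) * (κ * k + σ * j))) * γ j ^ (1 / p₁))) →
      ∑' k, c k ^ p ≤ C * ∑' j, l j ^ p * smoothing ε γ j := by
  have hpi : 0 < p⁻¹ := by
    rw [hp]
    have := mul_pos (sub_pos.2 hθ₁) (inv_pos.2 hp₀)
    have := mul_pos hθ₀ (inv_pos.2 hp₁)
    linarith
  have hp0 : 0 < p := inv_pos.1 hpi
  set d := p₀⁻¹ - p₁⁻¹ with hd
  -- Small enough that adding `d * log G` to `j ↦ σ * j` changes each step by at most `σ / 2`.
  set ε := σ / (2 * (|d| + 1)) with hεdef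
  have hd1 : 0 < |d| + 1 := by positivity
  have hε : 0 < ε := by positivity
  have hεd : |d| * ε ≤ σ / 2 := by
    rw [hεdef, mul_div_assoc', div_le_div_iff₀ (by positivity) (by norm_num)]
    nlinarith [abs_nonneg d]
  have hCtop : (ex 0 + ex (3 * σ / 2)) ^ p ≠ ∞ :=
    ENNReal.rpow_ne_top_of_nonneg hp0.le (ENNReal.add_ne_top.2 ⟨ex_ne_top _, ex_ne_top _⟩)
  refine ⟨((ex 0 + ex (3 * σ / 2)) ^ p).toNNReal, ε, hε, fun c l γ hl hc => ?_⟩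
  rw [ENNReal.coe_toNNReal hCtop]
  set G := smoothing ε γ with hG
  have hGle : ∀ j m : ℤ, G j ≤ ex (ε * |((j : ℝ) - m)|) * G m := smoothing_le hε.le γ
  by_cases hGt : ∃ j, G j = ∞
  · obtain ⟨j, hj⟩ := hGt
    have hc0 : (ex 0 + ex (3 * σ / 2)) ^ p ≠ 0 := by
      simp [ENNReal.rpow_eq_zero_iff, ex_ne_zero, hp0.not_gt]
    have : ∑' j, l j ^ p * G j = ∞ := by
      refine ENNReal.tsum_eq_top_of_eq_top ⟨j, ?_⟩
      rw [hj, ENNReal.mul_top]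
      simp [ENNReal.rpow_eq_zero_iff, hl j, hp0.not_gt]
    rw [this, ENNReal.mul_top hc0]
    exact le_top
  push Not at hGt
  have hγG : ∀ j, γ j ≤ G j := le_smoothing ε γ
  by_cases hG0 : ∃ j, G j = 0
  · obtain ⟨j, hj⟩ := hG0
    have hγ : γ j = 0 := by simpa [hj] using hγG j
    have : ∀ k, c k = 0 := by
      intro k
      have := hc k j
      simpa [hγ, hp₀, hp₁] using this
    simp [this, hp0]
  push Not at hG0
  choose L hL using fun j => exists_ex_eq (hG0 j) (hGt j)
  have hstep : ∀ j, |L (j + 1) - L j| ≤ ε := by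
    intro j
    have a := hGle (j + 1) j
    have b := hGle j (j + 1)
    rw [hL, hL, ← ex_add, ex_le_ex] at a b
    push_cast at a b
    rw [show ((j : ℝ) + 1 - j) = 1 by ring, abs_one] at a
    rw [show ((j : ℝ) - (j + 1)) = -1 by ring, abs_neg, abs_one] at b
    rw [abs_le]; constructor <;> linarith
  have hdstep : ∀ j, |d * (L (j + 1) - L j)| ≤ σ / 2 := by
    intro j
    rw [abs_mul]
    exact (mul_le_mul_of_nonneg_left (hstep j) (abs_nonneg d)).trans hεd
  -- With `G j = ex (L j)`, the two terms are both `G j ^ (1 / p)` exactly when `κ * k + σ * j + d *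
  -- L j = 0`. An integer `j` solves this up to an error in `[-3σ/2, 0]`.
  have key : ∀ k : ℤ, ∃ j : ℤ, σ * j + d * L j ≤ -(κ * k) ∧
      -(κ * k) ≤ σ * j + d * L j + 3 * σ / 2 := by
    intro k
    refine exists_index_of_steps (h := fun j : ℤ => σ * j + d * L j) hσ ?_ ?_ (-(κ * k)) <;>
    · intro j
      have := abs_le.1 (hdstep j)
      push_cast
      nlinarith
  choose J hJ1 hJ2 using key
  -- Two indices with the same `J` would put `κ * k` and `κ * k'` within `3σ/2` of each other,
  -- whereas distinct values are at least `|κ| ≥ 2σ` apart.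
  have hinj : Function.Injective J := by
    intro k k' hkk
    by_contra hne
    have a1 := hJ1 k
    have a2 := hJ2 k
    have b1 := hJ1 k'
    have b2 := hJ2 k'
    rw [hkk] at a1 a2
    have h1 : |κ * (k - k')| ≤ 3 * σ / 2 := by rw [abs_le]; constructor <;> linarith
    have h2 : (1 : ℝ) ≤ |(k : ℝ) - k'| := by
      have : (1 : ℤ) ≤ |k - k'| := Int.one_le_abs (sub_ne_zero.2 hne)
      exact_mod_cast this
    rw [abs_mul] at h1
    nlinarith [abs_nonneg κ]
  have hbound : ∀ k, c k ^ p ≤ (ex 0 + ex (3 * σ / 2)) ^ p * (l (J k) ^ p * G (J k)) := by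
    intro k
    have h1 : c k ≤ l (J k) * ((ex 0 + ex (3 * σ / 2)) * G (J k) ^ (1 / p)) := by
      refine (hc k (J k)).trans ?_
      gcongr
      rw [add_mul]
      set j := J k
      have e1 : γ j ^ (1 / p₀) ≤ ex (L j * (1 / p₀)) := by
        rw [← ex_rpow, ← hL]; gcongr; exact hγG j
      have e2 : γ j ^ (1 / p₁) ≤ ex (L j * (1 / p₁)) := by
        rw [← ex_rpow, ← hL]; gcongr; exact hγG j
      have hpd : 1 / p = (1 - θ) * p₀⁻¹ + θ * p₁⁻¹ := by rw [one_div, hp]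
      have f1 := hJ1 k
      have f2 := hJ2 k
      set D := κ * k + (σ * j + d * L j) with hD
      have hD0 : D ≤ 0 := by rw [hD]; linarith
      have hD1 : -(3 * σ / 2) ≤ D := by rw [hD]; linarith
      refine add_le_add ?_ ?_
      · refine (mul_le_mul_right e1 _).trans ?_
        rw [hL, ex_rpow, ← ex_add, ← ex_add, hpd]
        apply ex_mono
        have : θ * (κ * k + σ * j) + L j * (1 / p₀) =
          θ * D + L j * ((1 - θ) * p₀⁻¹ + θ * p₁⁻¹) := by rw [hD, hd]; ring
        rw [this]
        nlinarith
      · refine (mul_le_mul_right e2 _).trans ?_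
        rw [hL, ex_rpow, ← ex_add, ← ex_add, hpd]
        apply ex_mono
        have : -((1 - θ) * (κ * k + σ * j)) + L j * (1 / p₁) =
          -((1 - θ) * D) + L j * ((1 - θ) * p₀⁻¹ + θ * p₁⁻¹) := by rw [hD, hd]; ring
        rw [this]
        nlinarith
    calc c k ^ p ≤ (l (J k) * ((ex 0 + ex (3 * σ / 2)) * G (J k) ^ (1 / p))) ^ p := by gcongr
      _ = _ := by
        rw [ENNReal.mul_rpow_of_nonneg _ _ hp0.le, ENNReal.mul_rpow_of_nonneg _ _ hp0.le,
          ← ENNReal.rpow_mul, one_div_mul_cancel hp0.ne', ENNReal.rpow_one]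
        ring
  calc ∑' k, c k ^ p ≤ ∑' k, (ex 0 + ex (3 * σ / 2)) ^ p * (l (J k) ^ p * G (J k)) :=
        ENNReal.tsum_le_tsum hbound
    _ = (ex 0 + ex (3 * σ / 2)) ^ p * ∑' k, (l (J k) ^ p * G (J k)) := ENNReal.tsum_mul_left
    _ ≤ _ := by
      refine mul_le_mul_right ?_ _
      exact ENNReal.tsum_comp_le_tsum_of_injective hinj (fun j => l j ^ p * G j)

/-! ### Threshold cut-offs of sequences. -/

/-- Summing over scales the `q`-sums of a sequence cut off below a moving threshold, in
logarithmic form. -/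
theorem exists_tsum_cutoff_le {P P' q η σ κ : ℝ} (hP : 0 < P) (hP' : 0 < P') (hq : 0 < q)
    (hη : 0 < η) (hσ : 0 < σ) (hκ : κ ≠ 0) :
    ∃ C : ℝ≥0, ∀ (A : Set ℤ) (x : ℤ → ℝ),
      ∑' i : ℤ, ex (-(η * (σ * i))) *
        (∑' k : ℤ, {k | k ∈ A ∧ P * x k ≤ σ * i + P' * (κ * k + x k)}.indicator
          (fun k => ex (q * x k)) k) ^ (P / q) ≤
      C * ∑' k : ℤ, A.indicator
          (fun k => ex (P * x k + η * (P' * (κ * k + x k) - P * x k))) k := by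
  -- Half of the decay in `i` pays for passing from the `ℓ^q` sum to a sum of `P`-th powers; the
  -- other half makes the sum over `i` converge.
  set ε := η / 2 with hε
  have hε0 : 0 < ε := by positivity
  set r := P' - P with hr
  set c := (P / ε + |r|)⁻¹ with hc
  have hc0 : 0 < c := by positivity
  obtain ⟨C₁, hC₁⟩ := exists_tsum_ex_neg_abs_le (c := q * c) (α := P' * κ) (by positivity)
    (mul_ne_zero hP'.ne' hκ)
  obtain ⟨C₂, hC₂⟩ := exists_tsum_ex_neg_abs_le (c := ε) (α := σ) hε0 hσ.ne'
  refine ⟨C₁ ^ (P / q) * C₂, fun A x => ?_⟩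
  set S : ℤ → Set ℤ := fun i => {k | k ∈ A ∧ P * x k ≤ σ * i + P' * (κ * k + x k)} with hS
  set y : ℤ → ℝ := fun k => P' * (κ * k + x k) - P * x k with hy
  -- Each term on the right is at most the whole sum `M = ex m`. Since `σ * i + y k ≥ 0` on `S i`,
  -- this forces `x k ≤ m / P`, with a deficit growing linearly in the distance of `k` from a
  -- central index. The `ℓ^q` sum is thus geometric, whatever the relation between `q` and `P`.
  have main : ∀ i : ℤ, (∑' k : ℤ, (S i).indicator (fun k => ex (q * x k)) k) ^ (P / q) ≤
      (C₁ : ℝ≥0∞) ^ (P / q) *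
        ∑' k : ℤ, (S i).indicator (fun k => ex (P * x k + ε * (σ * i + y k))) k := by
    intro i
    set M := ∑' k : ℤ, (S i).indicator (fun k => ex (P * x k + ε * (σ * i + y k))) k with hM
    have hle : ∀ k ∈ S i, ex (P * x k + ε * (σ * i + y k)) ≤ M := by
      intro k hk
      refine le_trans (le_of_eq ?_) (ENNReal.le_tsum k)
      rw [indicator_of_mem hk]
    rcases (S i).eq_empty_or_nonempty with hemp | ⟨k0, hk0⟩
    · simp [hemp, div_pos hP hq]
    have hM0 : M ≠ 0 := ((ex_pos _).trans_le (hle k0 hk0)).ne'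
    have hq' : 0 < P / q := div_pos hP hq
    by_cases hMt : M = ∞
    · rw [hMt]
      by_cases hC0 : (C₁ : ℝ≥0∞) = 0
      · have := hC₁ 0
        rw [hC0, nonpos_iff_eq_zero, ENNReal.tsum_eq_zero] at this
        exact absurd (this 0) (ex_ne_zero _)
      · rw [ENNReal.mul_top]
        · exact le_top
        · simp [ENNReal.rpow_eq_zero_iff, hC0, hq'.not_gt]
    obtain ⟨m, hm⟩ := exists_ex_eq hM0 hMt
    have hterm : ∀ k, (S i).indicator (fun k => ex (q * x k)) k ≤
        ex (q * (m / P)) * ex (-(q * c * |P' * κ * k + (σ * i + r * (m / P))|)) := by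
      intro k
      by_cases hk : k ∈ S i
      · rw [indicator_of_mem hk, ← ex_add]
        apply ex_mono
        have h1 := hle k hk
        rw [hm, ex_le_ex] at h1
        have h2 : 0 ≤ σ * i + y k := by
          have := hk.2
          simp only [hy]; linarith
        set Y := σ * i + y k with hY
        -- Removing the multiple of `x k - m / P` leaves an affine function of `k` with nonzero
        -- slope; its absolute value is what the deficit controls.
        have h3 : P' * κ * k + (σ * i + r * (m / P)) = Y - r * (x k - m / P) := by
          simp only [hY, hy, hr]; ring
        have h4 : P * (x k - m / P) + ε * Y ≤ 0 := by
          have : P * (m / P) = m := by field_simp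
          nlinarith
        rw [h3]
        set ξ := x k - m / P with hξ
        have h5 : ξ ≤ 0 := by
          by_contra hcon
          push Not at hcon
          nlinarith [mul_pos hP hcon, mul_nonneg hε0.le h2]
        have h6 : |Y - r * ξ| ≤ (P / ε + |r|) * (-ξ) := by
          refine (abs_sub _ _).trans ?_
          rw [abs_of_nonneg h2, abs_mul, abs_of_nonpos h5]
          have : Y ≤ P / ε * (-ξ) := by
            rw [div_mul_eq_mul_div, le_div_iff₀ hε0]
            linarith
          linarith
        have h7 : c * |Y - r * ξ| ≤ -ξ := by
          rw [hc, inv_mul_le_iff₀ (by positivity)]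
          exact h6
        have h8 := mul_le_mul_of_nonneg_left h7 hq.le
        have : q * x k = q * (m / P) + q * ξ := by rw [hξ]; ring
        linarith
      · rw [indicator_of_notMem hk]; exact zero_le
    calc (∑' k : ℤ, (S i).indicator (fun k => ex (q * x k)) k) ^ (P / q)
        ≤ (∑' k : ℤ, ex (q * (m / P)) *
            ex (-(q * c * |P' * κ * k + (σ * i + r * (m / P))|))) ^ (P / q) := by
          gcongr; exact hterm _
      _ ≤ (ex (q * (m / P)) * C₁) ^ (P / q) := by
          rw [ENNReal.tsum_mul_left]; gcongr; exact hC₁ _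
      _ = _ := by
          rw [ENNReal.mul_rpow_of_nonneg _ _ hq'.le, ex_rpow, mul_comm, hm]
          congr 2; field_simp
  calc _ ≤ ∑' i : ℤ, ex (-(η * (σ * i))) * ((C₁ : ℝ≥0∞) ^ (P / q) *
        ∑' k : ℤ, (S i).indicator (fun k => ex (P * x k + ε * (σ * i + y k))) k) := by
        gcongr; exact main _
    _ = (C₁ : ℝ≥0∞) ^ (P / q) * ∑' k : ℤ, ∑' i : ℤ, ex (-(η * (σ * i))) *
         (S i).indicator (fun k => ex (P * x k + ε * (σ * i + y k))) k := by
        rw [ENNReal.tsum_comm, ← ENNReal.tsum_mul_left]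
        congr 1; ext i
        rw [ENNReal.tsum_mul_left]; ring
    _ ≤ (C₁ : ℝ≥0∞) ^ (P / q) * ∑' k : ℤ, C₂ * A.indicator
          (fun k => ex (P * x k + η * y k)) k := by
        gcongr with k
        by_cases hk : k ∈ A
        · rw [indicator_of_mem hk, mul_comm]
          refine le_trans ?_ (mul_le_mul_right (hC₂ (y k)) _)
          rw [← ENNReal.tsum_mul_left]
          refine ENNReal.tsum_le_tsum fun i => ?_
          by_cases hki : k ∈ S i
          · rw [indicator_of_mem hki, ← ex_add, ← ex_add]
            apply ex_mono
            have h2 : 0 ≤ σ * i + y k := by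
              have := hki.2
              simp only [hy]; linarith
            rw [abs_of_nonneg h2, hε]
            linarith
          · rw [indicator_of_notMem hki, mul_zero]; exact zero_le
        · have : ∀ i, k ∉ S i := fun i h => hk h.1
          simp [this]
    _ = _ := by
        rw [ENNReal.tsum_mul_left, ← mul_assoc, ENNReal.coe_mul,
          ENNReal.coe_rpow_of_nonneg _ (div_pos hP hq).le]

/-- The condition `(e^{κ₀ k} a)^P ≤ e^υ (e^{κ₁ k} a)^{P'}`, in logarithmic form. -/
def BelowThreshold (P P' κ₀ κ₁ υ : ℝ) (k : ℤ) (a : ℝ≥0∞) : Prop :=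
  P * (κ₀ * k + Real.log a.toReal) ≤ υ + P' * (κ₁ * k + Real.log a.toReal)

/-- The cut-off bound with `x k = κ₀ k + log (a k)`; the relations `h₀`, `h₁` collapse the resulting
product of powers to a `p`-th power at the intermediate weight. Where `a k = 0` the convention `log
0 = 0` makes the threshold meaningless, but the summand vanishes; infinite values are excluded
because `toReal` sends them to `0`. -/
theorem exists_tsum_belowThreshold_le {P P' q η σ κ₀ κ₁ θ p : ℝ} (hP : 0 < P) (hP' : 0 < P')
    (hq : 0 < q) (hη : 0 < η) (hσ : 0 < σ) (hκ : κ₀ ≠ κ₁)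
    (h₀ : P * (1 - η) = p * (1 - θ)) (h₁ : P' * η = p * θ) :
    ∃ C : ℝ≥0, ∀ a : ℤ → ℝ≥0∞, (∀ k, a k ≠ ∞) →
      ∑' i : ℤ, ex (-(η * (σ * i))) *
        (∑' k : ℤ, {k | BelowThreshold P P' κ₀ κ₁ (σ * i) k (a k)}.indicator
          (fun k => (ex (κ₀ * k) * a k) ^ q) k) ^ (P / q) ≤
      C * ∑' k : ℤ, (ex (((1 - θ) * κ₀ + θ * κ₁) * k) * a k) ^ p := by
  obtain ⟨C, hC⟩ := exists_tsum_cutoff_le (κ := κ₁ - κ₀) hP hP' hq hη hσ (sub_ne_zero.2 hκ.symm)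
  refine ⟨C, fun a ha => ?_⟩
  set x : ℤ → ℝ := fun k => κ₀ * k + Real.log (a k).toReal with hx
  have hex : ∀ k, a k ≠ 0 → a k = ex (Real.log (a k).toReal) := by
    intro k hk
    rw [ex, Real.exp_log (ENNReal.toReal_pos hk (ha k)), ENNReal.ofReal_toReal (ha k)]
  refine le_trans ?_ ((hC {k | a k ≠ 0} x).trans ?_)
  · gcongr with i k
    by_cases hk : BelowThreshold P P' κ₀ κ₁ (σ * i) k (a k)
    · rw [indicator_of_mem (by exact hk)]
      by_cases hak : a k = 0
      · simp [hak, hq]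
      · rw [indicator_of_mem]
        · nth_rewrite 1 [hex k hak]
          rw [← ex_add, ex_rpow]
          apply ex_mono
          simp only [hx]; linarith
        · refine ⟨hak, ?_⟩
          have hk' := hk
          rw [BelowThreshold] at hk'
          simp only [hx]
          linarith
    · rw [indicator_of_notMem (by exact hk)]; exact zero_le
  · gcongr with k
    by_cases hak : a k = 0
    · simp [hak]
    · rw [indicator_of_mem (by exact hak)]
      nth_rewrite 1 [hex k hak]
      rw [← ex_add, ex_rpow]
      apply ex_mono
      apply le_of_eq
      simp only [hx]
      linear_combination (κ₀ * k + Real.log (a k).toReal) * h₀ +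
        (κ₁ * k + Real.log (a k).toReal) * h₁

/-- The complementary condition is the same one with the two endpoints exchanged: `θ` and `η` become
`1 - θ` and `1 - η`, and `i` becomes `-i`. -/
theorem exists_tsum_not_belowThreshold_le {P P' q η σ κ₀ κ₁ θ p : ℝ} (hP : 0 < P) (hP' : 0 < P')
    (hq : 0 < q) (hη : η < 1) (hσ : 0 < σ) (hκ : κ₀ ≠ κ₁)
    (h₀ : P * (1 - η) = p * (1 - θ)) (h₁ : P' * η = p * θ) :
    ∃ C : ℝ≥0, ∀ a : ℤ → ℝ≥0∞, (∀ k, a k ≠ ∞) →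
      ∑' i : ℤ, ex ((1 - η) * (σ * i)) *
        (∑' k : ℤ, {k | ¬ BelowThreshold P P' κ₀ κ₁ (σ * i) k (a k)}.indicator
          (fun k => (ex (κ₁ * k) * a k) ^ q) k) ^ (P' / q) ≤
      C * ∑' k : ℤ, (ex (((1 - θ) * κ₀ + θ * κ₁) * k) * a k) ^ p := by
  obtain ⟨C, hC⟩ := exists_tsum_belowThreshold_le (θ := 1 - θ) (p := p) hP' hP hq (sub_pos.2 hη) hσ
    hκ.symm (by linarith) (by linarith)
  refine ⟨C, fun a ha => ?_⟩
  refine le_trans ?_ ((hC a ha).trans (le_of_eq ?_))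
  · rw [← (Equiv.neg ℤ).tsum_eq (fun i : ℤ => ex (-((1 - η) * (σ * i))) * _)]
    refine ENNReal.tsum_le_tsum fun i => ?_
    refine mul_le_mul' (ex_mono (by push_cast [Equiv.neg_apply]; linarith)) ?_
    gcongr with k
    intro hk
    simp only [BelowThreshold, not_le] at hk ⊢
    push_cast [Equiv.neg_apply]
    linarith
  · congr 1
    refine tsum_congr fun k => ?_
    rw [show (1 - (1 - θ)) * κ₁ + (1 - θ) * κ₀ = (1 - θ) * κ₀ + θ * κ₁ by ring]

/-! ### Levels and boxes in the upper half-space -/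

/-- The interval `[e^{τk}, e^{τ(k+1)})`. -/
def level (τ : ℝ) (k : ℤ) : Set ℝ := Ico (Real.exp (τ * k)) (Real.exp (τ * (k + 1)))

theorem measurableSet_level (τ : ℝ) (k : ℤ) : MeasurableSet (level τ k) := measurableSet_Ico

theorem level_subset_Ioi (τ : ℝ) (k : ℤ) : level τ k ⊆ Ioi 0 :=
  fun _ ht => (Real.exp_pos _).trans_le ht.1

theorem mem_level_iff {τ t : ℝ} {k : ℤ} (ht : 0 < t) :
    t ∈ level τ k ↔ τ * k ≤ Real.log t ∧ Real.log t < τ * (k + 1) := by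
  rw [level, mem_Ico, Real.le_log_iff_exp_le ht, Real.log_lt_iff_lt_exp ht]

theorem mem_level_iff_floor {τ t : ℝ} (hτ : 0 < τ) {k : ℤ} (ht : 0 < t) :
    t ∈ level τ k ↔ ⌊Real.log t / τ⌋ = k := by
  rw [mem_level_iff ht, Int.floor_eq_iff, le_div_iff₀ hτ, div_lt_iff₀ hτ, mul_comm τ,
    mul_comm τ]

theorem iUnion_level {τ : ℝ} (hτ : 0 < τ) : ⋃ k, level τ k = Ioi 0 := by
  apply Subset.antisymm (iUnion_subset fun k => level_subset_Ioi τ k)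
  intro t ht
  exact mem_iUnion.2 ⟨_, (mem_level_iff_floor hτ ht).2 rfl⟩

theorem pairwise_disjoint_level {τ : ℝ} (hτ : 0 < τ) :
    Pairwise (Function.onFun Disjoint (level τ)) := by
  intro k l hkl
  rw [Function.onFun, Set.disjoint_left]
  intro t hk hl
  have ht := level_subset_Ioi _ _ hk
  exact hkl (((mem_level_iff_floor hτ ht).1 hk).symm.trans ((mem_level_iff_floor hτ ht).1 hl))

theorem dtOverT_compl_Ioi : dtOverT (Ioi 0)ᶜ = 0 := by
  rw [dtOverT]
  apply withDensity_absolutelyContinuous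
  rw [Measure.restrict_apply measurableSet_Ioi.compl, compl_inter_self, measure_empty]

theorem ae_dtOverT_pos : ∀ᵐ t ∂dtOverT, 0 < t := by
  rw [ae_iff]
  exact dtOverT_compl_Ioi

instance : SFinite dtOverT := by unfold dtOverT; infer_instance

theorem lintegral_dtOverT_eq_tsum {τ : ℝ} (hτ : 0 < τ) (F : ℝ → ℝ≥0∞) :
    ∫⁻ t, F t ∂dtOverT = ∑' k : ℤ, ∫⁻ t in level τ k, F t ∂dtOverT := by
  rw [← lintegral_iUnion (measurableSet_level τ) (pairwise_disjoint_level hτ), iUnion_level hτ,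
    Measure.restrict_eq_self_of_ae_mem (s := Ioi 0) ae_dtOverT_pos]

theorem dtOverT_level (τ : ℝ) (k : ℤ) :
    dtOverT (level τ k) = ∫⁻ t in level τ k, ENNReal.ofReal t⁻¹ := by
  rw [dtOverT, withDensity_apply _ (measurableSet_level τ k),
    Measure.restrict_restrict (measurableSet_level τ k),
    inter_eq_left.2 (level_subset_Ioi τ k)]

theorem dtOverT_level_le (τ : ℝ) (k : ℤ) :
    dtOverT (level τ k) ≤ ENNReal.ofReal (Real.exp τ - 1) := by
  rw [dtOverT_level]
  calc _ ≤ ∫⁻ t in level τ k, ENNReal.ofReal (Real.exp (-(τ * k))) := by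
        refine setLIntegral_mono' (measurableSet_level τ k) fun t ht => ?_
        apply ENNReal.ofReal_le_ofReal
        rw [Real.exp_neg]
        exact inv_anti₀ (Real.exp_pos _) ht.1
    _ = _ := by
        rw [setLIntegral_const, level, Real.volume_Ico, ← ENNReal.ofReal_mul (Real.exp_pos _).le,
          mul_sub, ← Real.exp_add, ← Real.exp_add]
        congr 1
        rw [show -(τ * k) + τ * (k + 1) = τ by ring, neg_add_cancel, Real.exp_zero]

theorem le_dtOverT_level (τ : ℝ) (k : ℤ) :
    ENNReal.ofReal (1 - Real.exp (-τ)) ≤ dtOverT (level τ k) := by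
  rw [dtOverT_level]
  calc _ = ∫⁻ t in level τ k, ENNReal.ofReal (Real.exp (-(τ * (k + 1)))) := by
        rw [setLIntegral_const, level, Real.volume_Ico, ← ENNReal.ofReal_mul (Real.exp_pos _).le,
          mul_sub, ← Real.exp_add, ← Real.exp_add]
        congr 1
        rw [show -(τ * (k + 1)) + τ * k = -τ by ring, neg_add_cancel, Real.exp_zero]
    _ ≤ _ := by
        refine setLIntegral_mono' (measurableSet_level τ k) fun t ht => ?_
        apply ENNReal.ofReal_le_ofReal
        rw [Real.exp_neg]
        exact inv_anti₀ (level_subset_Ioi τ k ht) ht.2.le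

variable {n : ℕ}

/-- The index of the cube of side `h` in the standard grid that contains `x`. -/
noncomputable def cubeIdx (h : ℝ) (x : EuclideanSpace ℝ (Fin n)) : Fin n → ℤ :=
  fun i => ⌊x i / h⌋

theorem measurable_cubeIdx (h : ℝ) :
    Measurable (cubeIdx h : EuclideanSpace ℝ (Fin n) → Fin n → ℤ) := by
  refine measurable_pi_lambda _ fun i => Int.measurable_floor.comp ?_
  exact Measurable.div_const (by fun_prop) h

/-- The vector `h j` of the lattice `h ℤⁿ`. -/
noncomputable def latticeVec (h : ℝ) (j : Fin n → ℤ) : EuclideanSpace ℝ (Fin n) :=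
  WithLp.toLp 2 fun i => h * j i

theorem cubeIdx_add_latticeVec {h : ℝ} (hh : 0 < h) (x : EuclideanSpace ℝ (Fin n))
    (j : Fin n → ℤ) : cubeIdx h (x + latticeVec h j) = cubeIdx h x + j := by
  ext i
  simp only [cubeIdx, latticeVec, PiLp.add_apply, Pi.add_apply]
  rw [add_div, mul_div_cancel_left₀ _ hh.ne', Int.floor_add_intCast]

/-- The lattice offsets with entries bounded by `R`. -/
noncomputable def offsets (n : ℕ) (R : ℕ) : Finset (Fin n → ℤ) :=
  Fintype.piFinset fun _ => Finset.Icc (-(R : ℤ)) R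

/-- Points at distance comparable to `h` lie in cubes whose indices differ boundedly; the extra `h`
pays for the two floors. Expressing the neighbouring cube through a translate of `x` lets
translation invariance of Lebesgue measure remove the offset later. -/
theorem exists_mem_offsets {h : ℝ} (hh : 0 < h) {R : ℕ} {x y : EuclideanSpace ℝ (Fin n)}
    (hxy : dist y x + h ≤ R * h) :
    ∃ j ∈ offsets n R, cubeIdx h y = cubeIdx h (x + latticeVec h j) := by
  refine ⟨cubeIdx h y - cubeIdx h x, ?_, ?_⟩
  · rw [offsets, Fintype.mem_piFinset]
    intro i
    have h1 : |y i - x i| ≤ dist y x := by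
      rw [dist_eq_norm]
      exact PiLp.norm_apply_le (y - x) i
    have h2 : |y i / h - x i / h| + 1 ≤ R := by
      rw [← sub_div, abs_div, abs_of_pos hh, div_add_one hh.ne', div_le_iff₀ hh]
      linarith
    have a1 := Int.floor_le (y i / h)
    have a2 := Int.lt_floor_add_one (y i / h)
    have a3 := Int.floor_le (x i / h)
    have a4 := Int.lt_floor_add_one (x i / h)
    have a5 := abs_le.1 (le_sub_iff_add_le.2 h2)
    simp only [cubeIdx, Pi.sub_apply, Finset.mem_Icc]
    constructor
    · have : -(R : ℝ) ≤ ⌊y i / h⌋ - ⌊x i / h⌋ := by linarith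
      exact_mod_cast this
    · have : (⌊y i / h⌋ : ℝ) - ⌊x i / h⌋ ≤ R := by linarith
      exact_mod_cast this
  · rw [cubeIdx_add_latticeVec hh, add_sub_cancel]

theorem dist_le_of_cubeIdx_eq {h : ℝ} (hh : 0 < h) {x y : EuclideanSpace ℝ (Fin n)}
    (hxy : cubeIdx h y = cubeIdx h x) : dist y x ≤ n * h := by
  rw [EuclideanSpace.dist_eq]
  have hi : ∀ i, dist (y i) (x i) ≤ h := by
    intro i
    have := congrFun hxy i
    have := Int.abs_sub_lt_one_of_floor_eq_floor this
    rw [← sub_div, abs_div, abs_of_pos hh, div_lt_one hh] at this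
    exact this.le
  have hs : ∑ i, dist (y i) (x i) ≤ n * h := by
    simpa using Finset.sum_le_card_nsmul Finset.univ (fun i => dist (y i) (x i)) h
      (fun i _ => hi i)
  refine le_trans ?_ hs
  apply Real.sqrt_le_iff.2 ⟨Finset.sum_nonneg fun _ _ => dist_nonneg, ?_⟩
  exact Finset.sum_sq_le_sq_sum_of_nonneg fun _ _ => dist_nonneg

/-- The box at level `k` of the grid with mesh ratio `ε` that lies above `x`. -/
def box (ε τ : ℝ) (k : ℤ) (x : EuclideanSpace ℝ (Fin n)) : Set (EuclideanSpace ℝ (Fin n) × ℝ) :=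
  {y | cubeIdx (ε * Real.exp (τ * k)) y = cubeIdx (ε * Real.exp (τ * k)) x} ×ˢ level τ k

theorem measurableSet_box (ε τ : ℝ) (k : ℤ) (x : EuclideanSpace ℝ (Fin n)) :
    MeasurableSet (box ε τ k x) :=
  ((measurable_cubeIdx _) (measurableSet_singleton _)).prod (measurableSet_level τ k)

/-- The normalised `L^q` mean of `g` over the box at level `k` above `x`. -/
noncomputable def boxMean (ε τ q : ℝ) (g : EuclideanSpace ℝ (Fin n) × ℝ → ℂ) (k : ℤ)
    (x : EuclideanSpace ℝ (Fin n)) : ℝ≥0∞ :=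
  (ex (-(n * τ) * k) * ∫⁻ z in box ε τ k x, ‖g z‖ₑ ^ q
    ∂(halfSpaceMeasure (EuclideanSpace ℝ (Fin n)))) ^ (1 / q)

theorem boxMean_rpow {q : ℝ} (hq : 0 < q) (ε τ : ℝ) (g : EuclideanSpace ℝ (Fin n) × ℝ → ℂ) (k : ℤ)
    (x : EuclideanSpace ℝ (Fin n)) :
    boxMean ε τ q g k x ^ q = ex (-(n * τ) * k) * ∫⁻ z in box ε τ k x, ‖g z‖ₑ ^ q
      ∂(halfSpaceMeasure (EuclideanSpace ℝ (Fin n))) := by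
  rw [boxMean, ← ENNReal.rpow_mul, one_div_mul_cancel hq.ne', ENNReal.rpow_one]

theorem boxMean_congr_idx {ε τ q : ℝ} {g : EuclideanSpace ℝ (Fin n) × ℝ → ℂ} {k : ℤ}
    {x y : EuclideanSpace ℝ (Fin n)}
    (h : cubeIdx (ε * Real.exp (τ * k)) x = cubeIdx (ε * Real.exp (τ * k)) y) :
    boxMean ε τ q g k x = boxMean ε τ q g k y := by
  rw [boxMean, boxMean, box, box, h]

theorem measurable_boxMean (ε τ q : ℝ) (g : EuclideanSpace ℝ (Fin n) × ℝ → ℂ) (k : ℤ) :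
    Measurable (boxMean ε τ q g k) := by
  set F : (Fin n → ℤ) → ℝ≥0∞ := fun m =>
    (ex (-(n * τ) * k) * ∫⁻ z in ({y | cubeIdx (ε * Real.exp (τ * k)) y = m} ×ˢ level τ k),
      ‖g z‖ₑ ^ q ∂(halfSpaceMeasure (EuclideanSpace ℝ (Fin n)))) ^ (1 / q) with hF
  exact (Measurable.of_discrete (f := F)).comp (measurable_cubeIdx (ε * Real.exp (τ * k)))

theorem boxMean_congr_ae {ε τ q : ℝ} {g g' : EuclideanSpace ℝ (Fin n) × ℝ → ℂ}
    (h : g =ᵐ[halfSpaceMeasure (EuclideanSpace ℝ (Fin n))] g') (k : ℤ)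
    (x : EuclideanSpace ℝ (Fin n)) : boxMean ε τ q g k x = boxMean ε τ q g' k x := by
  rw [boxMean, boxMean]
  congr 2
  refine lintegral_congr_ae (ae_restrict_of_ae ?_)
  filter_upwards [h] with z hz
  rw [hz]

theorem boxMean_congr_on {ε τ q : ℝ} {g g' : EuclideanSpace ℝ (Fin n) × ℝ → ℂ} {k : ℤ}
    {x : EuclideanSpace ℝ (Fin n)} (h : ∀ z ∈ box ε τ k x, g z = g' z) :
    boxMean ε τ q g k x = boxMean ε τ q g' k x := by
  rw [boxMean, boxMean]
  congr 2
  refine setLIntegral_congr_fun (measurableSet_box ε τ k x) fun z hz => ?_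
  simp only [h z hz]

theorem boxMean_zero {ε τ q : ℝ} (hq : 0 < q) (k : ℤ) (x : EuclideanSpace ℝ (Fin n)) :
    boxMean ε τ q (fun _ => 0) k x = 0 := by
  simp [boxMean, hq]

theorem boxMean_add_le {q : ℝ} (hq : 0 < q) (ε τ : ℝ)
    {g g' : EuclideanSpace ℝ (Fin n) × ℝ → ℂ} (hg : Measurable g) (k : ℤ)
    (x : EuclideanSpace ℝ (Fin n)) :
    boxMean ε τ q (g + g') k x ≤
      2 * (2 : ℝ≥0∞) ^ (1 / q) * (boxMean ε τ q g k x + boxMean ε τ q g' k x) := by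
  have h1 : ∫⁻ z in box ε τ k x, ‖(g + g') z‖ₑ ^ q
      ∂(halfSpaceMeasure (EuclideanSpace ℝ (Fin n))) ≤ (2 : ℝ≥0∞) ^ q *
      (∫⁻ z in box ε τ k x, ‖g z‖ₑ ^ q ∂(halfSpaceMeasure (EuclideanSpace ℝ (Fin n))) +
      ∫⁻ z in box ε τ k x, ‖g' z‖ₑ ^ q ∂(halfSpaceMeasure (EuclideanSpace ℝ (Fin n)))) := by
    rw [← lintegral_add_left (by fun_prop), ← lintegral_const_mul' _ _ (by simp)]
    refine lintegral_mono fun z => ?_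
    refine le_trans ?_ (add_rpow_le_two_mul _ _ hq)
    gcongr
    exact enorm_add_le _ _
  calc boxMean ε τ q (g + g') k x
      ≤ ((2 : ℝ≥0∞) ^ q * (boxMean ε τ q g k x ^ q + boxMean ε τ q g' k x ^ q)) ^ (1 / q) := by
        rw [boxMean_rpow hq, boxMean_rpow hq, ← mul_add, boxMean]
        rw [mul_left_comm]
        gcongr
    _ = 2 * (boxMean ε τ q g k x ^ q + boxMean ε τ q g' k x ^ q) ^ (1 / q) := by
        rw [ENNReal.mul_rpow_of_nonneg _ _ (by positivity), ← ENNReal.rpow_mul,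
          mul_one_div_cancel hq.ne', ENNReal.rpow_one]
    _ ≤ 2 * ((2 : ℝ≥0∞) ^ (1 / q) *
          ((boxMean ε τ q g k x ^ q) ^ (1 / q) + (boxMean ε τ q g' k x ^ q) ^ (1 / q))) := by
        gcongr
        exact add_rpow_le_two_mul _ _ (by positivity)
    _ = _ := by
        rw [← ENNReal.rpow_mul, ← ENNReal.rpow_mul, mul_one_div_cancel hq.ne', ENNReal.rpow_one,
          ENNReal.rpow_one, mul_assoc]

/-! ### The weight and the measure -/

theorem exists_volume_ball_eq_ex (n : ℕ) :
    ∃ w : ℝ, ∀ (y : EuclideanSpace ℝ (Fin n)) (t : ℝ), 0 < t →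
      volume (Metric.ball y t) = ex (n * Real.log t + w) := by
  obtain ⟨w, hw⟩ := exists_ex_eq
    (Metric.measure_ball_pos volume (0 : EuclideanSpace ℝ (Fin n)) one_pos).ne'
    measure_ball_lt_top.ne
  refine ⟨w, fun y t ht => ?_⟩
  rw [Measure.addHaar_ball_of_pos _ _ ht, hw, finrank_euclideanSpace_fin, ex_add]
  congr 1
  rw [ex, Real.exp_nat_mul, Real.exp_log ht]

theorem enorm_volWeight {s v : ℝ} {f : EuclideanSpace ℝ (Fin n) × ℝ → ℂ}
    {z : EuclideanSpace ℝ (Fin n) × ℝ} (hv : volume (Metric.ball z.1 z.2) = ex v) :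
    ‖volWeight s f z‖ₑ = ex (s * v) * ‖f z‖ₑ := by
  rw [volWeight, enorm_mul, hv]
  congr 1
  rw [← ofReal_norm, Complex.norm_real, ex, ENNReal.toReal_ofReal (Real.exp_pos _).le,
    ← Real.exp_mul, Real.norm_eq_abs, abs_of_pos (Real.exp_pos _), ex, mul_comm]

theorem halfSpaceMeasure_eq :
    halfSpaceMeasure (EuclideanSpace ℝ (Fin n)) =
      (((volume : Measure (EuclideanSpace ℝ (Fin n))).prod (volume : Measure ℝ)).restrict
        (univ ×ˢ Ioi 0)).withDensity fun z => ENNReal.ofReal z.2⁻¹ := by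
  rw [halfSpaceMeasure, dtOverT, prod_withDensity_right (by fun_prop), ← Measure.prod_restrict,
    Measure.restrict_univ]

/-- Whitney averages use `dξ dτ` while box means use `dy dt / t`; the factor `z.2` is the density
between them. -/
theorem setLIntegral_prod_eq {A : Set (EuclideanSpace ℝ (Fin n) × ℝ)} (hA : MeasurableSet A)
    (hA0 : ∀ z ∈ A, 0 < z.2) (F : EuclideanSpace ℝ (Fin n) × ℝ → ℝ≥0∞) :
    ∫⁻ z in A, F z ∂((volume : Measure (EuclideanSpace ℝ (Fin n))).prod (volume : Measure ℝ)) =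
      ∫⁻ z in A, ENNReal.ofReal z.2 * F z ∂(halfSpaceMeasure (EuclideanSpace ℝ (Fin n))) := by
  rw [halfSpaceMeasure_eq, restrict_withDensity hA, Measure.restrict_restrict hA,
    inter_eq_left.2 (show A ⊆ univ ×ˢ Ioi 0 from fun z hz => ⟨mem_univ _, hA0 z hz⟩),
    lintegral_withDensity_eq_lintegral_mul_non_measurable _ (by fun_prop)
      (ae_of_all _ fun _ => ENNReal.ofReal_lt_top)]
  refine setLIntegral_congr_fun hA fun z hz => ?_
  have h0 := hA0 z hz
  simp only [Pi.mul_apply]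
  rw [← mul_assoc, ← ENNReal.ofReal_mul (inv_nonneg.2 h0.le), inv_mul_cancel₀ h0.ne',
    ENNReal.ofReal_one, one_mul]

theorem ae_halfSpaceMeasure_pos :
    ∀ᵐ z ∂(halfSpaceMeasure (EuclideanSpace ℝ (Fin n))), 0 < z.2 := by
  rw [halfSpaceMeasure_eq]
  refine (withDensity_absolutelyContinuous _ _).ae_le ?_
  filter_upwards [ae_restrict_mem (MeasurableSet.univ.prod measurableSet_Ioi)] with z hz
  exact hz.2

/-- On a level, the weight and the volume of balls are comparable to exponentials. -/
theorem exists_weight_bounds (n : ℕ) {τ : ℝ} (hτ : 0 < τ) (s : ℝ) :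
    ∃ B : ℝ, ∀ (k : ℤ) (z : EuclideanSpace ℝ (Fin n) × ℝ), z.2 ∈ level τ k →
      (∀ f : EuclideanSpace ℝ (Fin n) × ℝ → ℂ,
        ‖volWeight (-s) f z‖ₑ ≤ ex (B + -(s * (n * τ)) * k) * ‖f z‖ₑ ∧
        ex (-B + -(s * (n * τ)) * k) * ‖f z‖ₑ ≤ ‖volWeight (-s) f z‖ₑ) ∧
      volume (Metric.ball z.1 z.2) ≤ ex (B + n * τ * k) ∧
      ex (-B + n * τ * k) ≤ volume (Metric.ball z.1 z.2) := by
  obtain ⟨w, hw⟩ := exists_volume_ball_eq_ex n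
  set B₀ := n * τ + |w| with hB₀
  have hB₀0 : 0 ≤ B₀ := by positivity
  refine ⟨(|s| + 1) * B₀, fun k z hz => ?_⟩
  have hz0 := level_subset_Ioi _ _ hz
  have hv := hw z.1 z.2 hz0
  set v := n * Real.log z.2 + w with hvdef
  have hvB : |v - n * τ * k| ≤ B₀ := by
    obtain ⟨h1, h2⟩ := (mem_level_iff hz0).1 hz
    have h3 : |Real.log z.2 - τ * k| ≤ τ := by
      rw [abs_le]; constructor <;> nlinarith
    calc |v - n * τ * k| = |n * (Real.log z.2 - τ * k) + w| := by rw [hvdef]; ring_nf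
      _ ≤ |(n : ℝ) * (Real.log z.2 - τ * k)| + |w| := abs_add_le _ _
      _ ≤ n * τ + |w| := by
        rw [abs_mul, abs_of_nonneg (Nat.cast_nonneg n)]
        gcongr
  have hsB : |-s * v - -(s * (n * τ)) * k| ≤ |s| * B₀ := by
    rw [show -s * v - -(s * (n * τ)) * k = -s * (v - n * τ * k) by ring, abs_mul, abs_neg]
    gcongr
  rw [abs_le] at hvB hsB
  have hs0 := mul_nonneg (abs_nonneg s) hB₀0
  refine ⟨fun f => ?_, ?_, ?_⟩
  · rw [enorm_volWeight hv]
    constructor <;> gcongr <;> apply ex_mono <;> linarith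
  · rw [hv]; apply ex_mono; linarith
  · rw [hv]; apply ex_mono; linarith

theorem le_ex_mul_of_rpow_le {a b : ℝ≥0∞} {c q : ℝ} (hq : 0 < q)
    (h : a ^ q ≤ ex c * b ^ q) : a ≤ ex (c / q) * b := by
  rw [← ENNReal.rpow_le_rpow_iff hq, ENNReal.mul_rpow_of_nonneg _ _ hq.le, ex_rpow,
    div_mul_cancel₀ _ hq.ne']
  exact h

theorem mul_boxMean_rpow {q : ℝ} (hq : 0 < q) (ε τ κ : ℝ)
    (g : EuclideanSpace ℝ (Fin n) × ℝ → ℂ) (k : ℤ) (x : EuclideanSpace ℝ (Fin n)) :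
    (ex (κ * k) * boxMean ε τ q g k x) ^ q = ∫⁻ z in box ε τ k x,
      ex (κ * k * q + -(n * τ) * k) * ‖g z‖ₑ ^ q
      ∂(halfSpaceMeasure (EuclideanSpace ℝ (Fin n))) := by
  rw [ENNReal.mul_rpow_of_nonneg _ _ hq.le, boxMean_rpow hq, ex_rpow, ← mul_assoc, ← ex_add,
    lintegral_const_mul' _ _ (ex_ne_top _)]

/-! ### Comparison of the functionals with box means -/

/-- For `n * ε < 1` the diameter of a box is smaller than its least height, so the box above `x`
lies in the cone at `x`. The constant is independent of `k`, which is what allows a supremum over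
`k`. -/
theorem exists_boxMean_le_lusin {ε τ q : ℝ} (hε : 0 < ε) (hεn : n * ε < 1) (hτ : 0 < τ)
    (hq : 0 < q) (s : ℝ) :
    ∃ C : ℝ≥0, ∀ (f : EuclideanSpace ℝ (Fin n) × ℝ → ℂ) (k : ℤ) (x : EuclideanSpace ℝ (Fin n)),
      ex (-(s * (n * τ)) * k) * boxMean ε τ q f k x ≤ C * lusin q (volWeight (-s) f) x := by
  obtain ⟨B, hB⟩ := exists_weight_bounds n hτ s
  refine ⟨(ex ((q * B + B) / q)).toNNReal, fun f k x => ?_⟩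
  rw [ENNReal.coe_toNNReal (ex_ne_top _)]
  apply le_ex_mul_of_rpow_le hq
  rw [lusin, ← ENNReal.rpow_mul, one_div_mul_cancel hq.ne', ENNReal.rpow_one,
    mul_boxMean_rpow hq, ← lintegral_const_mul' _ _ (ex_ne_top _)]
  have hsub : box ε τ k x ⊆ cone x := by
    rintro z ⟨hz1, hz2⟩
    refine ⟨level_subset_Ioi _ _ hz2, ?_⟩
    rw [Metric.mem_ball]
    have h1 := dist_le_of_cubeIdx_eq (by positivity) hz1
    have h2 := Real.exp_pos (τ * k)
    calc dist z.1 x ≤ n * ε * Real.exp (τ * k) := by rw [mul_assoc]; exact h1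
      _ < 1 * Real.exp (τ * k) := by gcongr
      _ ≤ z.2 := by rw [one_mul]; exact hz2.1
  refine le_trans ?_ (lintegral_mono_set hsub)
  refine setLIntegral_mono' (measurableSet_box ε τ k x) fun z hz => ?_
  obtain ⟨h1, h2, -⟩ := hB k z hz.2
  have h3 := (h1 f).2
  calc ex (-(s * (n * τ)) * k * q + -(n * τ) * k) * ‖f z‖ₑ ^ q
      = ex (q * B + B) * ((ex (-B + -(s * (n * τ)) * k) * ‖f z‖ₑ) ^ q *
          (ex (B + n * τ * k))⁻¹) := by
        rw [ENNReal.mul_rpow_of_nonneg _ _ hq.le, ex_rpow, ex_inv,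
          mul_right_comm (ex _) (‖f z‖ₑ ^ q)]
        simp only [← mul_assoc, ← ex_add]
        congr 2; ring
    _ ≤ _ := by rw [div_eq_mul_inv]; gcongr

/-- At level `k` the cone is contained in a ball of radius `e^{τ(k+1)}`, a fixed multiple of the
cube side, so one finite set of lattice offsets covers it at every level. -/
theorem exists_lusin_rpow_le {ε τ q : ℝ} (hε : 0 < ε) (hτ : 0 < τ) (hq : 0 < q) (s : ℝ) :
    ∃ C : ℝ≥0, ∃ R : ℕ, ∀ (f : EuclideanSpace ℝ (Fin n) × ℝ → ℂ)
      (x : EuclideanSpace ℝ (Fin n)),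
      lusin q (volWeight (-s) f) x ^ q ≤ C * ∑ j ∈ offsets n R, ∑' k : ℤ,
        (ex (-(s * (n * τ)) * k) *
          boxMean ε τ q f k (x + latticeVec (ε * Real.exp (τ * k)) j)) ^ q := by
  obtain ⟨B, hB⟩ := exists_weight_bounds n hτ s
  obtain ⟨R, hR⟩ := exists_nat_ge (Real.exp τ / ε + 1)
  refine ⟨(ex (q * B + B)).toNNReal, R, fun f x => ?_⟩
  rw [ENNReal.coe_toNNReal (ex_ne_top _), lusin, ← ENNReal.rpow_mul, one_div_mul_cancel hq.ne',
    ENNReal.rpow_one]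
  have hsub : cone x ⊆ ⋃ j : offsets n R, ⋃ k : ℤ,
      box ε τ k (x + latticeVec (ε * Real.exp (τ * k)) (j : Fin n → ℤ)) := by
    rintro z ⟨hz1, hz2⟩
    obtain ⟨k, hk⟩ : ∃ k, z.2 ∈ level τ k := by
      have : z.2 ∈ ⋃ k, level τ k := by rw [iUnion_level hτ]; exact hz1
      exact mem_iUnion.1 this
    have hh : 0 < ε * Real.exp (τ * k) := by positivity
    obtain ⟨j, hj, hj'⟩ := exists_mem_offsets (R := R) hh (x := x) (y := z.1) (by
      rw [Metric.mem_ball] at hz2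
      have h1 := hk.2
      rw [mul_add, mul_one, Real.exp_add] at h1
      have h2 : (Real.exp τ / ε + 1) * (ε * Real.exp (τ * k)) ≤ R * (ε * Real.exp (τ * k)) := by
        gcongr
      have h3 : (Real.exp τ / ε + 1) * (ε * Real.exp (τ * k)) =
        Real.exp (τ * k) * Real.exp τ + ε * Real.exp (τ * k) := by field_simp
      linarith)
    exact mem_iUnion.2 ⟨⟨j, hj⟩, mem_iUnion.2 ⟨k, hj', hk⟩⟩
  rw [← Finset.tsum_subtype, ← ENNReal.tsum_mul_left]
  refine (lintegral_mono_set hsub).trans ((lintegral_iUnion_le _ _).trans ?_)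
  refine ENNReal.tsum_le_tsum fun j => ?_
  rw [← ENNReal.tsum_mul_left]
  refine (lintegral_iUnion_le _ _).trans ?_
  refine ENNReal.tsum_le_tsum fun k => ?_
  rw [mul_boxMean_rpow hq, ← lintegral_const_mul' _ _ (ex_ne_top _)]
  refine setLIntegral_mono' (measurableSet_box ε τ k _) fun z hz => ?_
  obtain ⟨h1, -, h2⟩ := hB k z hz.2
  have h3 := (h1 f).1
  calc _ ≤ (ex (B + -(s * (n * τ)) * k) * ‖f z‖ₑ) ^ q * (ex (-B + n * τ * k))⁻¹ := by
        rw [div_eq_mul_inv]; gcongr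
    _ = _ := by
        rw [ENNReal.mul_rpow_of_nonneg _ _ hq.le, ex_rpow, ex_inv,
          mul_right_comm (ex _) (‖f z‖ₑ ^ q)]
        simp only [← mul_assoc, ← ex_add]
        congr 2; ring

theorem exists_volume_whitneyRegion_eq_ex (n : ℕ) {c₀ c₁ : ℝ} (hc₀ : 0 < c₀) (hc₁ : 1 < c₁) :
    ∃ w : ℝ, ∀ (x : EuclideanSpace ℝ (Fin n)) (t : ℝ), 0 < t →
      ((volume : Measure (EuclideanSpace ℝ (Fin n))).prod (volume : Measure ℝ))
        (whitneyRegion c₀ c₁ x t) = ex ((n + 1) * Real.log t + w) := by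
  obtain ⟨w, hw⟩ := exists_volume_ball_eq_ex n
  have hc : 0 < c₁ - c₁⁻¹ := by
    have : c₁⁻¹ < 1 := inv_lt_one_of_one_lt₀ hc₁
    linarith
  refine ⟨n * Real.log c₀ + w + Real.log (c₁ - c₁⁻¹), fun x t ht => ?_⟩
  rw [whitneyRegion, Measure.prod_prod, hw x _ (by positivity), Real.volume_Ioo, ← sub_mul,
    ← Real.exp_log (mul_pos hc ht), ← ex, ← ex_add, Real.log_mul hc₀.ne' ht.ne',
    Real.log_mul hc.ne' ht.ne']
  congr 1; ring

theorem whitneyAverage_rpow {c₀ c₁ q w : ℝ} (hq : 0 < q)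
    (hw : ∀ (x : EuclideanSpace ℝ (Fin n)) (t : ℝ), 0 < t →
      ((volume : Measure (EuclideanSpace ℝ (Fin n))).prod (volume : Measure ℝ))
        (whitneyRegion c₀ c₁ x t) = ex ((n + 1) * Real.log t + w)) (hc₁ : 1 < c₁)
    (g : EuclideanSpace ℝ (Fin n) × ℝ → ℂ) (x : EuclideanSpace ℝ (Fin n)) {t : ℝ} (ht : 0 < t) :
    whitneyAverage q c₀ c₁ g (x, t) ^ q = ∫⁻ z in whitneyRegion c₀ c₁ x t,
      ex (-((n + 1) * Real.log t + w)) * (ENNReal.ofReal z.2 * ‖g z‖ₑ ^ q)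
        ∂(halfSpaceMeasure (EuclideanSpace ℝ (Fin n))) := by
  rw [whitneyAverage, ← ENNReal.rpow_mul, one_div_mul_cancel hq.ne', ENNReal.rpow_one,
    setLAverage_eq, hw x t ht, div_eq_mul_inv, ex_inv, mul_comm,
    lintegral_const_mul' _ _ (ex_ne_top _),
    ← setLIntegral_prod_eq (A := whitneyRegion c₀ c₁ x t)
      (Metric.isOpen_ball.measurableSet.prod measurableSet_Ioo)
      (fun z hz => lt_trans (by have := one_pos.trans hc₁; positivity) hz.2.1)]

/-- Two heights in one level have ratio less than `e^τ ≤ c₁`, and `n * ε < c₀` controls the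
horizontal distance; hence the box lies in the Whitney region of every `(x, t)` at its level. -/
theorem exists_boxMean_le_whitneyAverage {ε τ q c₀ c₁ : ℝ} (hε : 0 < ε) (hεn : n * ε < c₀)
    (hτ : 0 < τ) (hτc : Real.exp τ ≤ c₁) (hc₀ : 0 < c₀) (hc₁ : 1 < c₁) (hq : 0 < q) (s : ℝ) :
    ∃ C : ℝ≥0, ∀ (f : EuclideanSpace ℝ (Fin n) × ℝ → ℂ) (k : ℤ) (x : EuclideanSpace ℝ (Fin n))
      (t : ℝ), t ∈ level τ k →
      ex (-(s * (n * τ)) * k) * boxMean ε τ q f k x ≤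
        C * whitneyAverage q c₀ c₁ (volWeight (-s) f) (x, t) := by
  obtain ⟨B, hB⟩ := exists_weight_bounds n hτ s
  obtain ⟨w, hw⟩ := exists_volume_whitneyRegion_eq_ex n hc₀ hc₁
  refine ⟨(ex (((n + 1) * τ + w + q * B) / q)).toNNReal, fun f k x t ht => ?_⟩
  have ht0 : 0 < t := level_subset_Ioi _ _ ht
  have hc₁0 : 0 < c₁ := one_pos.trans hc₁
  rw [ENNReal.coe_toNNReal (ex_ne_top _)]
  apply le_ex_mul_of_rpow_le hq
  rw [whitneyAverage_rpow hq hw hc₁ _ _ ht0, mul_boxMean_rpow hq,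
    ← lintegral_const_mul' _ _ (ex_ne_top _)]
  have hexp : Real.exp (τ * (k + 1)) = Real.exp (τ * k) * Real.exp τ := by
    rw [← Real.exp_add]; ring_nf
  have hsub : box ε τ k x ⊆ whitneyRegion c₀ c₁ x t := by
    rintro z ⟨hz1, hz2⟩
    have h2 := Real.exp_pos (τ * k)
    have hz0 : 0 < z.2 := level_subset_Ioi _ _ hz2
    have ht1 := ht.1
    have ht2 := ht.2
    have hz3 := hz2.1
    have hz4 := hz2.2
    rw [hexp] at ht2 hz4
    refine ⟨?_, ?_, ?_⟩
    · rw [Metric.mem_ball]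
      have h1 := dist_le_of_cubeIdx_eq (by positivity) hz1
      calc dist z.1 x ≤ n * ε * Real.exp (τ * k) := by rw [mul_assoc]; exact h1
        _ < c₀ * Real.exp (τ * k) := by gcongr
        _ ≤ c₀ * t := by gcongr
    · rw [inv_mul_lt_iff₀ hc₁0, mul_comm]
      calc t < Real.exp (τ * k) * Real.exp τ := ht2
        _ ≤ z.2 * c₁ := by gcongr
    · calc z.2 < Real.exp (τ * k) * Real.exp τ := hz4
        _ ≤ t * c₁ := by gcongr
        _ = c₁ * t := mul_comm _ _
  refine le_trans ?_ (lintegral_mono_set hsub)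
  refine setLIntegral_mono' (measurableSet_box ε τ k x) fun z hz => ?_
  have h3 := ((hB k z hz.2).1 f).2
  have h4 : ex (τ * k) ≤ ENNReal.ofReal z.2 := ENNReal.ofReal_le_ofReal hz.2.1
  have h5 := ((mem_level_iff ht0).1 ht).2
  calc ex (-(s * (n * τ)) * k * q + -(n * τ) * k) * ‖f z‖ₑ ^ q
      = ex ((n + 1) * τ + w + q * B) * (ex (-((n + 1) * (τ * (k + 1)) + w)) * (ex (τ * k) *
          (ex (-B + -(s * (n * τ)) * k) * ‖f z‖ₑ) ^ q)) := by
        rw [ENNReal.mul_rpow_of_nonneg _ _ hq.le, ex_rpow]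
        simp only [← mul_assoc, ← ex_add]
        congr 2; ring
    _ ≤ _ := by
        gcongr
        apply ex_mono
        have : (n + 1) * Real.log t ≤ (n + 1) * (τ * (k + 1)) := by gcongr
        linarith

theorem exists_whitneyAverage_rpow_le {ε τ q c₀ c₁ : ℝ} (hε : 0 < ε)
    (hτ : 0 < τ) (hc₀ : 0 < c₀) (hc₁ : 1 < c₁) (hq : 0 < q) (s : ℝ) :
    ∃ C : ℝ≥0, ∃ R : ℕ, ∃ I : Finset ℤ, ∀ (f : EuclideanSpace ℝ (Fin n) × ℝ → ℂ) (k : ℤ)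
      (x : EuclideanSpace ℝ (Fin n)) (t : ℝ), t ∈ level τ k →
      whitneyAverage q c₀ c₁ (volWeight (-s) f) (x, t) ^ q ≤
        C * ∑ u ∈ I ×ˢ offsets n R, (ex (-(s * (n * τ)) * (k + u.1 : ℤ)) *
          boxMean ε τ q f (k + u.1)
            (x + latticeVec (ε * Real.exp (τ * (k + u.1 : ℤ))) u.2)) ^ q := by
  obtain ⟨B, hB⟩ := exists_weight_bounds n hτ s
  obtain ⟨w, hw⟩ := exists_volume_whitneyRegion_eq_ex n hc₀ hc₁
  -- Heights in the region differ from `t` by a factor less than `c₁`, so level indices differ by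
  -- less than `M`; the `+ 1` accounts for the positions inside the two levels.
  obtain ⟨M, hM⟩ := exists_nat_ge (Real.log c₁ / τ + 1)
  obtain ⟨R, hR⟩ := exists_nat_ge (c₀ * Real.exp (τ * (M + 1)) / ε + 1)
  have hc₁0 : 0 < c₁ := one_pos.trans hc₁
  refine ⟨(ex ((n + 1) * τ * M + τ + q * B - w)).toNNReal, R, Finset.Icc (-M) M,
    fun f k x t ht => ?_⟩
  have ht0 : 0 < t := level_subset_Ioi _ _ ht
  obtain ⟨ht1, ht2⟩ := (mem_level_iff ht0).1 ht
  rw [ENNReal.coe_toNNReal (ex_ne_top _), whitneyAverage_rpow hq hw hc₁ _ _ ht0]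
  have hM' : Real.log c₁ ≤ (M - 1) * τ := by
    rw [← div_le_iff₀ hτ]; linarith
  have hsub : whitneyRegion c₀ c₁ x t ⊆
      ⋃ u : ((Finset.Icc (-M : ℤ) M) ×ˢ offsets n R : Finset (ℤ × (Fin n → ℤ))),
      box ε τ (k + u.1.1) (x + latticeVec (ε * Real.exp (τ * (k + u.1.1 : ℤ))) u.1.2) := by
    rintro z ⟨hz1, hz2, hz3⟩
    have hz0 : 0 < z.2 := lt_trans (by positivity) hz2
    obtain ⟨m, hm⟩ : ∃ k, z.2 ∈ level τ k := by
      have : z.2 ∈ ⋃ k, level τ k := by rw [iUnion_level hτ]; exact hz0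
      exact mem_iUnion.1 this
    obtain ⟨hm1, hm2⟩ := (mem_level_iff hz0).1 hm
    have hl1 := Real.log_lt_log (by positivity) hz2
    have hl2 := Real.log_lt_log hz0 hz3
    rw [Real.log_mul (by positivity) (by positivity), Real.log_inv] at hl1
    rw [Real.log_mul (by positivity) (by positivity)] at hl2
    have hmk1 : (m : ℝ) - k < M := by
      by_contra hcon
      push Not at hcon
      nlinarith
    have hmk2 : -(M : ℝ) < m - k := by
      by_contra hcon
      push Not at hcon
      nlinarith
    have hh : 0 < ε * Real.exp (τ * m) := by positivity
    obtain ⟨j, hj, hj'⟩ := exists_mem_offsets (R := R) hh (x := x) (y := z.1) (by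
      rw [Metric.mem_ball] at hz1
      have h1 : t ≤ Real.exp (τ * (M + 1)) * Real.exp (τ * m) := by
        rw [← Real.exp_add]
        refine ht.2.le.trans (Real.exp_le_exp.2 ?_)
        nlinarith
      have h2 : (c₀ * Real.exp (τ * (M + 1)) / ε + 1) * (ε * Real.exp (τ * m)) ≤
          R * (ε * Real.exp (τ * m)) := by gcongr
      have h3 : (c₀ * Real.exp (τ * (M + 1)) / ε + 1) * (ε * Real.exp (τ * m)) =
        c₀ * (Real.exp (τ * (M + 1)) * Real.exp (τ * m)) + ε * Real.exp (τ * m) := by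
          field_simp
      have h4 : c₀ * t ≤ c₀ * (Real.exp (τ * (M + 1)) * Real.exp (τ * m)) := by gcongr
      linarith)
    refine mem_iUnion.2 ⟨⟨(m - k, j), ?_⟩, ?_⟩
    · simp only [Finset.mem_product, Finset.mem_Icc]
      refine ⟨⟨?_, ?_⟩, hj⟩
      · exact_mod_cast hmk2.le
      · exact_mod_cast hmk1.le
    · simp only [add_sub_cancel]
      exact ⟨hj', hm⟩
  rw [← Finset.tsum_subtype (Finset.Icc (-M : ℤ) M ×ˢ offsets n R)
    (fun u => (ex (-(s * (n * τ)) * (k + u.1 : ℤ)) * boxMean ε τ q f (k + u.1)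
      (x + latticeVec (ε * Real.exp (τ * (k + u.1 : ℤ))) u.2)) ^ q), ← ENNReal.tsum_mul_left]
  refine (lintegral_mono_set hsub).trans ((lintegral_iUnion_le _ _).trans ?_)
  refine ENNReal.tsum_le_tsum fun u => ?_
  have hu := (Finset.mem_Icc.1 (Finset.mem_product.1 u.2).1).2
  have hu' : ((u.1.1 : ℤ) : ℝ) ≤ M := by exact_mod_cast hu
  rw [mul_boxMean_rpow hq, ← lintegral_const_mul' _ _ (ex_ne_top _)]
  refine setLIntegral_mono' (measurableSet_box ε τ _ _) fun z hz => ?_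
  have h3 := ((hB _ z hz.2).1 f).1
  have h4 : ENNReal.ofReal z.2 ≤ ex (τ * ((k + u.1.1 : ℤ) + 1)) :=
    ENNReal.ofReal_le_ofReal hz.2.2.le
  have h5 : (n + 1) * (τ * k) ≤ (n + 1) * Real.log t := by gcongr
  have h6 : ((n : ℝ) + 1) * τ * u.1.1 ≤ (n + 1) * τ * M := by gcongr
  calc _ ≤ ex (-((n + 1) * (τ * k) + w)) * (ex (τ * ((k + u.1.1 : ℤ) + 1)) *
          (ex (B + -(s * (n * τ)) * (k + u.1.1 : ℤ)) * ‖f z‖ₑ) ^ q) := by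
        gcongr
        apply ex_mono
        linarith
    _ ≤ _ := by
        rw [ENNReal.mul_rpow_of_nonneg _ _ hq.le, ex_rpow]
        simp only [← mul_assoc, ← ex_add]
        gcongr
        apply ex_mono
        push_cast
        nlinarith

/-! ### Discretisation of the interpolation quasi-norm -/

section Interpolation

variable {A : Type*} [AddCommGroup A]

theorem KFunctional_mono (N₀ N₁ : A → ℝ≥0∞) (a : A) {t t' : ℝ} (h : t ≤ t') :
    KFunctional N₀ N₁ t a ≤ KFunctional N₀ N₁ t' a := by
  unfold KFunctional
  gcongr

theorem KFunctional_le {N₀ N₁ : A → ℝ≥0∞} {a a₀ a₁ : A} (t : ℝ) (h₀ : N₀ a₀ < ∞) (h₁ : N₁ a₁ < ∞)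
    (h : a = a₀ + a₁) : KFunctional N₀ N₁ t a ≤ N₀ a₀ + ENNReal.ofReal t * N₁ a₁ :=
  iInf₂_le_of_le a₀ h₀ (iInf₂_le_of_le a₁ h₁ (iInf_le _ h))

theorem exists_of_KFunctional_lt {N₀ N₁ : A → ℝ≥0∞} {a : A} {t : ℝ} {K : ℝ≥0∞}
    (h : KFunctional N₀ N₁ t a < K) :
    ∃ a₀ a₁, N₀ a₀ < ∞ ∧ N₁ a₁ < ∞ ∧ a = a₀ + a₁ ∧ N₀ a₀ + ENNReal.ofReal t * N₁ a₁ < K := by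
  simp only [KFunctional, iInf_lt_iff] at h
  obtain ⟨a₀, h₀, a₁, h₁, h, hK⟩ := h
  exact ⟨a₀, a₁, h₀, h₁, h, hK⟩

theorem interpNorm_rpow {r : ℝ} (hr : 0 < r) (N₀ N₁ : A → ℝ≥0∞) (θ : ℝ) (a : A) :
    interpNorm N₀ N₁ θ r a ^ r =
      ∫⁻ t, (ENNReal.ofReal (t ^ (-θ)) * KFunctional N₀ N₁ t a) ^ r ∂dtOverT := by
  rw [interpNorm, ← ENNReal.rpow_mul, one_div_mul_cancel hr.ne', ENNReal.rpow_one]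

theorem ofReal_rpow_bounds {κ θ t : ℝ} (hθ : 0 < θ) {k : ℤ} (ht : t ∈ level κ k) :
    ENNReal.ofReal (t ^ (-θ)) ≤ ex (-(θ * (κ * k))) ∧
      ex (-(θ * (κ * (k + 1)))) ≤ ENNReal.ofReal (t ^ (-θ)) := by
  have ht0 : 0 < t := level_subset_Ioi _ _ ht
  obtain ⟨h1, h2⟩ := (mem_level_iff ht0).1 ht
  rw [Real.rpow_def_of_pos ht0, ← ex]
  constructor <;> apply ex_mono <;> nlinarith

theorem exists_interpNorm_rpow_le_tsum {κ θ r : ℝ} (hκ : 0 < κ) (hθ : 0 < θ) (hr : 0 < r) :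
    ∃ C : ℝ≥0, ∀ (N₀ N₁ : A → ℝ≥0∞) (a : A), interpNorm N₀ N₁ θ r a ^ r ≤
      C * ∑' k : ℤ, (ex (-(θ * (κ * k))) * KFunctional N₀ N₁ (Real.exp (κ * k)) a) ^ r := by
  refine ⟨(ex (θ * κ) ^ r * ENNReal.ofReal (Real.exp κ - 1)).toNNReal, fun N₀ N₁ a => ?_⟩
  rw [ENNReal.coe_toNNReal (ENNReal.mul_ne_top (by rw [ex_rpow]; exact ex_ne_top _)
    ENNReal.ofReal_ne_top), interpNorm_rpow hr, lintegral_dtOverT_eq_tsum hκ,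
    ← ENNReal.tsum_mul_left]
  -- The K-functional increases in `t`, so on level `k` it is bounded by its value at the upper
  -- endpoint, which is the sample of index `k + 1`.
  rw [← (Equiv.addRight (1 : ℤ)).tsum_eq (fun k : ℤ => _ * (_ : ℝ≥0∞) ^ r)]
  refine ENNReal.tsum_le_tsum fun k => ?_
  simp only [Equiv.coe_addRight, Int.cast_add, Int.cast_one]
  set K := KFunctional N₀ N₁ (Real.exp (κ * (k + 1))) a
  calc _ ≤ ∫⁻ t in level κ k, (ex (-(θ * (κ * k))) * K) ^ r ∂dtOverT := by
        refine setLIntegral_mono' (measurableSet_level κ k) fun t ht => ?_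
        gcongr
        · exact (ofReal_rpow_bounds hθ ht).1
        · exact KFunctional_mono _ _ _ ht.2.le
    _ = (ex (-(θ * (κ * k))) * K) ^ r * dtOverT (level κ k) := setLIntegral_const _ _
    _ ≤ (ex (-(θ * (κ * k))) * K) ^ r * ENNReal.ofReal (Real.exp κ - 1) := by
        gcongr; exact dtOverT_level_le κ k
    _ = _ := by
        rw [mul_right_comm, ← ENNReal.mul_rpow_of_nonneg _ _ hr.le, ← mul_assoc (ex (θ * κ)), ← ex_add]
        congr 4; ring

theorem exists_tsum_le_interpNorm_rpow {κ θ r : ℝ} (hκ : 0 < κ) (hθ : 0 < θ) (hr : 0 < r) :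
    ∃ C : ℝ≥0, ∀ (N₀ N₁ : A → ℝ≥0∞) (a : A),
      ∑' k : ℤ, (ex (-(θ * (κ * k))) * KFunctional N₀ N₁ (Real.exp (κ * k)) a) ^ r ≤
        C * interpNorm N₀ N₁ θ r a ^ r := by
  have hc : 0 < 1 - Real.exp (-κ) := by
    rw [sub_pos, Real.exp_lt_one_iff]; linarith
  set m := ENNReal.ofReal (1 - Real.exp (-κ)) with hm
  have hm0 : m ≠ 0 := (ENNReal.ofReal_pos.2 hc).ne'
  have htop : ex (θ * κ) ^ r * m⁻¹ ≠ ∞ :=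
    ENNReal.mul_ne_top (by rw [ex_rpow]; exact ex_ne_top _) (ENNReal.inv_ne_top.2 hm0)
  refine ⟨(ex (θ * κ) ^ r * m⁻¹).toNNReal, fun N₀ N₁ a => ?_⟩
  rw [ENNReal.coe_toNNReal htop, interpNorm_rpow hr, lintegral_dtOverT_eq_tsum hκ,
    ← ENNReal.tsum_mul_left]
  refine ENNReal.tsum_le_tsum fun k => ?_
  set K := KFunctional N₀ N₁ (Real.exp (κ * k)) a with hK
  have h1 : (ex (-(θ * (κ * (k + 1)))) * K) ^ r * m ≤ ∫⁻ t in level κ k,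
      (ENNReal.ofReal (t ^ (-θ)) * KFunctional N₀ N₁ t a) ^ r ∂dtOverT := by
    calc _ ≤ (ex (-(θ * (κ * (k + 1)))) * K) ^ r * dtOverT (level κ k) := by
          gcongr; exact le_dtOverT_level κ k
      _ = ∫⁻ t in level κ k, (ex (-(θ * (κ * (k + 1)))) * K) ^ r ∂dtOverT :=
          (setLIntegral_const _ _).symm
      _ ≤ _ := by
          refine setLIntegral_mono' (measurableSet_level κ k) fun t ht => ?_
          gcongr
          · exact (ofReal_rpow_bounds hθ ht).2
          · exact KFunctional_mono _ _ _ ht.1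
  calc (ex (-(θ * (κ * k))) * K) ^ r
      = ex (θ * κ) ^ r * m⁻¹ * ((ex (-(θ * (κ * (k + 1)))) * K) ^ r * m) := by
        rw [mul_mul_mul_comm, mul_comm (ex (θ * κ) ^ r * _),
          ← ENNReal.mul_rpow_of_nonneg _ _ hr.le, ← mul_assoc, ← mul_assoc, ← ex_add,
          ENNReal.inv_mul_cancel hm0 ENNReal.ofReal_ne_top, one_mul]
        congr 3; ring
    _ ≤ _ := by gcongr

end Interpolation

/-! ### Comparison of the quasi-norms with box sums -/

theorem tentNorm_rpow {p : ℝ} (hp : 0 < p) (q s : ℝ) (f : L0 (EuclideanSpace ℝ (Fin n))) :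
    tentNorm p q s f ^ p = ∫⁻ x, lusin q (volWeight (-s) f) x ^ p := by
  rw [tentNorm, ← ENNReal.rpow_mul, one_div_mul_cancel hp.ne', ENNReal.rpow_one]

theorem zNorm_rpow {p : ℝ} (hp : 0 < p) (q s c₀ c₁ : ℝ) (f : L0 (EuclideanSpace ℝ (Fin n))) :
    zNorm p q s c₀ c₁ f ^ p = ∫⁻ z, whitneyAverage q c₀ c₁ (volWeight (-s) f) z ^ p
      ∂(halfSpaceMeasure (EuclideanSpace ℝ (Fin n))) := by
  rw [zNorm, ← ENNReal.rpow_mul, one_div_mul_cancel hp.ne', ENNReal.rpow_one]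

/-- The weighted `ℓ^p` sum of the box means of `f`, to the power `p`. -/
noncomputable def boxSum (ε τ p q s : ℝ) (f : EuclideanSpace ℝ (Fin n) × ℝ → ℂ) : ℝ≥0∞ :=
  ∑' k : ℤ, ∫⁻ x, (ex (-(s * (n * τ)) * k) * boxMean ε τ q f k x) ^ p

@[fun_prop]
theorem measurable_boxMean_comp (ε τ q : ℝ) (g : EuclideanSpace ℝ (Fin n) × ℝ → ℂ) (k : ℤ)
    {u : EuclideanSpace ℝ (Fin n) → EuclideanSpace ℝ (Fin n)} (hu : Measurable u) :
    Measurable fun x => boxMean ε τ q g k (u x) :=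
  (measurable_boxMean ε τ q g k).comp hu

theorem exists_lintegral_iSup_le_tentNorm {ε τ p q : ℝ} (hε : 0 < ε) (hεn : n * ε < 1)
    (hτ : 0 < τ) (hq : 0 < q) (hp : 0 < p) (s : ℝ) :
    ∃ C : ℝ≥0, ∀ f : L0 (EuclideanSpace ℝ (Fin n)),
      ∫⁻ x, (⨆ k : ℤ, ex (-(s * (n * τ)) * k) * boxMean ε τ q f k x) ^ p ≤
        C * tentNorm p q s f ^ p := by
  obtain ⟨C, hC⟩ := exists_boxMean_le_lusin (n := n) hε hεn hτ hq s
  refine ⟨C ^ p, fun f => ?_⟩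
  rw [tentNorm_rpow hp, ← lintegral_const_mul' _ _ ENNReal.coe_ne_top]
  refine lintegral_mono fun x => ?_
  rw [ENNReal.coe_rpow_of_nonneg _ hp.le, ← ENNReal.mul_rpow_of_nonneg _ _ hp.le]
  gcongr
  exact iSup_le fun k => hC f k x

theorem exists_tentNorm_rpow_le {ε τ p q : ℝ} (hε : 0 < ε) (hτ : 0 < τ) (hq : 0 < q) (hp : 0 < p)
    (s : ℝ) :
    ∃ C : ℝ≥0, ∃ R : ℕ, ∀ f : L0 (EuclideanSpace ℝ (Fin n)),
      tentNorm p q s f ^ p ≤ C * ∑ j ∈ offsets n R, ∫⁻ x, (∑' k : ℤ,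
        (ex (-(s * (n * τ)) * k) *
          boxMean ε τ q f k (x + latticeVec (ε * Real.exp (τ * k)) j)) ^ q) ^ (p / q) := by
  obtain ⟨C, R, hC⟩ := exists_lusin_rpow_le (n := n) hε hτ hq s
  have hpq : 0 < p / q := div_pos hp hq
  refine ⟨C ^ (p / q) * ((offsets n R).card : ℝ≥0) ^ (p / q), R, fun f => ?_⟩
  rw [tentNorm_rpow hp, ← lintegral_finsetSum _ (fun j _ => by fun_prop),
    ← lintegral_const_mul' _ _ ENNReal.coe_ne_top]
  refine lintegral_mono fun x => ?_
  calc lusin q (volWeight (-s) f) x ^ p = (lusin q (volWeight (-s) f) x ^ q) ^ (p / q) := by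
        rw [← ENNReal.rpow_mul, mul_div_cancel₀ _ hq.ne']
    _ ≤ (C * ∑ j ∈ offsets n R, ∑' k : ℤ, (ex (-(s * (n * τ)) * k) *
          boxMean ε τ q f k (x + latticeVec (ε * Real.exp (τ * k)) j)) ^ q) ^ (p / q) := by
        gcongr; exact hC f x
    _ ≤ _ := by
        rw [ENNReal.mul_rpow_of_nonneg _ _ hpq.le, ENNReal.coe_mul,
          ENNReal.coe_rpow_of_nonneg _ hpq.le, ENNReal.coe_rpow_of_nonneg _ hpq.le,
          ENNReal.coe_natCast, mul_assoc]
        gcongr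
        exact sum_rpow_le_card_mul _ _ hpq

theorem lintegral_halfSpaceMeasure_tsum {τ : ℝ} {H : ℤ → EuclideanSpace ℝ (Fin n) → ℝ≥0∞}
    (hH : ∀ k, Measurable (H k)) :
    ∫⁻ z, ∑' k : ℤ, H k z.1 * (level τ k).indicator 1 z.2
      ∂(halfSpaceMeasure (EuclideanSpace ℝ (Fin n))) =
      ∑' k : ℤ, (∫⁻ x, H k x) * dtOverT (level τ k) := by
  rw [lintegral_tsum]
  · refine tsum_congr fun k => ?_
    rw [halfSpaceMeasure, lintegral_prod_mul (hH k).aemeasurable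
      ((measurable_one.indicator (measurableSet_level τ k)).aemeasurable),
      lintegral_indicator_one (measurableSet_level τ k)]
  · intro k
    exact (((hH k).comp measurable_fst).mul
      ((measurable_one.indicator (measurableSet_level τ k)).comp measurable_snd)).aemeasurable

theorem tsum_mul_indicator_level {τ : ℝ} (hτ : 0 < τ) (F : ℤ → ℝ≥0∞) {k : ℤ} {t : ℝ}
    (ht : t ∈ level τ k) : ∑' l : ℤ, F l * (level τ l).indicator 1 t = F k := by
  rw [tsum_eq_single k, indicator_of_mem ht, Pi.one_apply, mul_one]
  intro l hl
  rw [indicator_of_notMem, mul_zero]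
  exact fun h => (pairwise_disjoint_level hτ hl).le_bot ⟨h, ht⟩

theorem exists_boxSum_le_zNorm {ε τ p q c₀ c₁ : ℝ} (hε : 0 < ε) (hεn : n * ε < c₀)
    (hτ : 0 < τ) (hτc : Real.exp τ ≤ c₁) (hc₀ : 0 < c₀) (hc₁ : 1 < c₁) (hq : 0 < q) (hp : 0 < p)
    (s : ℝ) :
    ∃ C : ℝ≥0, ∀ f : L0 (EuclideanSpace ℝ (Fin n)),
      boxSum ε τ p q s f ≤ C * zNorm p q s c₀ c₁ f ^ p := by
  obtain ⟨C, hC⟩ := exists_boxMean_le_whitneyAverage (n := n) hε hεn hτ hτc hc₀ hc₁ hq s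
  have hc : 0 < 1 - Real.exp (-τ) := by
    rw [sub_pos, Real.exp_lt_one_iff]; linarith
  set m := ENNReal.ofReal (1 - Real.exp (-τ)) with hm
  have hm0 : m ≠ 0 := (ENNReal.ofReal_pos.2 hc).ne'
  have htop : m⁻¹ * (C : ℝ≥0∞) ^ p ≠ ∞ :=
    ENNReal.mul_ne_top (ENNReal.inv_ne_top.2 hm0) (by simp [hp.le])
  refine ⟨(m⁻¹ * (C : ℝ≥0∞) ^ p).toNNReal, fun f => ?_⟩
  rw [ENNReal.coe_toNNReal htop, zNorm_rpow hp]
  set G : ℤ → EuclideanSpace ℝ (Fin n) → ℝ≥0∞ :=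
    fun k x => (ex (-(s * (n * τ)) * k) * boxMean ε τ q f k x) ^ p with hG
  have hGm : ∀ k, Measurable (G k) := fun k => by fun_prop
  calc boxSum ε τ p q s f = m⁻¹ * ∑' k : ℤ, (∫⁻ x, G k x) * m := by
        rw [ENNReal.tsum_mul_right, mul_left_comm, ENNReal.inv_mul_cancel hm0
          ENNReal.ofReal_ne_top, mul_one]
        rfl
    _ ≤ m⁻¹ * ∑' k : ℤ, (∫⁻ x, G k x) * dtOverT (level τ k) := by
        gcongr; exact le_dtOverT_level τ _
    _ = m⁻¹ * ∫⁻ z, ∑' k : ℤ, G k z.1 * (level τ k).indicator 1 z.2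
        ∂(halfSpaceMeasure (EuclideanSpace ℝ (Fin n))) := by
        rw [lintegral_halfSpaceMeasure_tsum hGm]
    _ ≤ _ := by
        rw [mul_assoc, ← lintegral_const_mul' ((C : ℝ≥0∞) ^ p) _ (by simp [hp.le])]
        refine mul_le_mul_right (lintegral_mono_ae ?_) _
        filter_upwards [ae_halfSpaceMeasure_pos] with z hz
        obtain ⟨k, hk⟩ : ∃ k, z.2 ∈ level τ k := by
          have : z.2 ∈ ⋃ k, level τ k := by rw [iUnion_level hτ]; exact hz
          exact mem_iUnion.1 this
        rw [tsum_mul_indicator_level hτ (fun k => G k z.1) hk,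
          ← ENNReal.mul_rpow_of_nonneg _ _ hp.le]
        exact ENNReal.rpow_le_rpow (hC f k z.1 z.2 hk) hp.le

theorem exists_zNorm_rpow_le_boxSum {ε τ p q c₀ c₁ : ℝ} (hε : 0 < ε)
    (hτ : 0 < τ) (hc₀ : 0 < c₀) (hc₁ : 1 < c₁) (hq : 0 < q) (hp : 0 < p) (s : ℝ) :
    ∃ C : ℝ≥0, ∀ f : L0 (EuclideanSpace ℝ (Fin n)),
      zNorm p q s c₀ c₁ f ^ p ≤ C * boxSum ε τ p q s f := by
  obtain ⟨C, R, I, hC⟩ := exists_whitneyAverage_rpow_le (n := n) hε hτ hc₀ hc₁ hq s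
  have hpq : 0 < p / q := div_pos hp hq
  set m := ENNReal.ofReal (Real.exp τ - 1) with hm
  set U := I ×ˢ offsets n R with hU
  set D := (C : ℝ≥0∞) ^ (p / q) * (U.card : ℝ≥0∞) ^ (p / q) with hD
  have hDtop : D ≠ ∞ := ENNReal.mul_ne_top (by simp [hpq.le]) (by simp [hpq.le])
  have htop : m * (D * U.card) ≠ ∞ := ENNReal.mul_ne_top ENNReal.ofReal_ne_top
    (ENNReal.mul_ne_top hDtop (by simp))
  refine ⟨(m * (D * U.card)).toNNReal, fun f => ?_⟩
  rw [ENNReal.coe_toNNReal htop, zNorm_rpow hp]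
  set G : ℤ → EuclideanSpace ℝ (Fin n) → ℝ≥0∞ :=
    fun k x => (ex (-(s * (n * τ)) * k) * boxMean ε τ q f k x) ^ p with hG
  set H : ℤ → EuclideanSpace ℝ (Fin n) → ℝ≥0∞ := fun k x =>
    D * ∑ u ∈ U, G (k + u.1) (x + latticeVec (ε * Real.exp (τ * (k + u.1 : ℤ))) u.2) with hH
  have hGm : ∀ k, Measurable (G k) := fun k => by fun_prop
  have hGm' : ∀ k v, Measurable (fun x => G k (x + v)) := fun k v => by fun_prop
  have hHm : ∀ k, Measurable (H k) := fun k =>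
    (Finset.measurable_sum U fun u _ => hGm' _ _).const_mul D
  calc _ ≤ ∫⁻ z, ∑' k : ℤ, H k z.1 * (level τ k).indicator 1 z.2
        ∂(halfSpaceMeasure (EuclideanSpace ℝ (Fin n))) := by
        refine lintegral_mono_ae ?_
        filter_upwards [ae_halfSpaceMeasure_pos] with z hz
        obtain ⟨k, hk⟩ : ∃ k, z.2 ∈ level τ k := by
          have : z.2 ∈ ⋃ k, level τ k := by rw [iUnion_level hτ]; exact hz
          exact mem_iUnion.1 this
        rw [tsum_mul_indicator_level hτ (fun k => H k z.1) hk]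
        calc _ = (whitneyAverage q c₀ c₁ (volWeight (-s) f) (z.1, z.2) ^ q) ^ (p / q) := by
              rw [← ENNReal.rpow_mul, mul_div_cancel₀ _ hq.ne']
          _ ≤ _ := ENNReal.rpow_le_rpow (hC f k z.1 z.2 hk) hpq.le
          _ ≤ _ := by
              rw [ENNReal.mul_rpow_of_nonneg _ _ hpq.le]
              simp only [hH, hD, mul_assoc]
              gcongr
              refine (sum_rpow_le_card_mul _ _ hpq).trans (le_of_eq ?_)
              congr 1
              refine Finset.sum_congr rfl fun u _ => ?_
              rw [← ENNReal.rpow_mul, mul_div_cancel₀ _ hq.ne']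
    _ = ∑' k : ℤ, (∫⁻ x, H k x) * dtOverT (level τ k) := lintegral_halfSpaceMeasure_tsum hHm
    _ ≤ ∑' k : ℤ, (D * ∑ u ∈ U, ∫⁻ x, G (k + u.1) x) * m := by
        gcongr with k
        · simp only [hH]
          rw [lintegral_const_mul' _ _ hDtop, lintegral_finsetSum _ (fun u _ => hGm' _ _)]
          exact mul_le_mul_right (Finset.sum_le_sum fun u _ =>
            (lintegral_add_right_eq_self (G (k + u.1)) _).le) _
        · exact dtOverT_level_le τ k
    _ = _ := by
        rw [ENNReal.tsum_mul_right, ENNReal.tsum_mul_left, Summable.tsum_finsetSum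
          (fun _ _ => ENNReal.summable)]
        have : ∀ u ∈ U, ∑' k : ℤ, ∫⁻ x, G (k + u.1) x = boxSum ε τ p q s f := fun u _ =>
          (Equiv.addRight u.1).tsum_eq (fun k => ∫⁻ x, G k x)
        rw [Finset.sum_congr rfl this, Finset.sum_const, nsmul_eq_mul]
        ring

/-! ### The interpolation space is contained in the Z-space -/

/-- Normalising by a bound for the quasi-norm gives functions whose integrals are bounded
independently of the decomposition index. -/
theorem lintegral_mul_inv_rpow_le {X : Type*} [MeasurableSpace X] {μ : Measure X}
    {A : X → ℝ≥0∞} {p : ℝ} {T N K : ℝ≥0∞} (hp : 0 < p) (h : ∫⁻ x, A x ^ p ∂μ ≤ T * N ^ p)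
    (hN : N ≤ K) (hK0 : K ≠ 0) (hK : K ≠ ∞) : ∫⁻ x, (A x * K⁻¹) ^ p ∂μ ≤ T := by
  simp_rw [ENNReal.mul_rpow_of_nonneg _ _ hp.le]
  rw [lintegral_mul_const' _ _
    (ENNReal.rpow_ne_top_of_nonneg hp.le (ENNReal.inv_ne_top.2 hK0))]
  calc _ ≤ T * N ^ p * K⁻¹ ^ p := by gcongr
    _ ≤ T * (K * K⁻¹) ^ p := by
        rw [mul_assoc, ← ENNReal.mul_rpow_of_nonneg _ _ hp.le]; gcongr
    _ = T := by rw [ENNReal.mul_inv_cancel hK0 hK, ENNReal.one_rpow, mul_one]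

theorem le_mul_rpow_of_mul_inv_rpow_le {a K g : ℝ≥0∞} {p : ℝ} (hp : 0 < p) (hK0 : K ≠ 0)
    (hK : K ≠ ∞) (h : (a * K⁻¹) ^ p ≤ g) : a ≤ K * g ^ (1 / p) := by
  have h1 : a * K⁻¹ ≤ g ^ (1 / p) := by
    rw [one_div]
    exact (ENNReal.le_rpow_inv_iff hp).2 h
  calc a = K * (a * K⁻¹) := by
        rw [mul_left_comm, ENNReal.mul_inv_cancel hK0 hK, mul_one]
    _ ≤ _ := by gcongr

theorem exists_boxSum_le_interpNorm {ε τ p₀ p₁ q s₀ s₁ θ p s : ℝ} (hn : 1 ≤ n) (hε : 0 < ε)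
    (hεn : n * ε < 1) (hτ : 0 < τ) (hp₀ : 0 < p₀) (hp₁ : 0 < p₁) (hq : 0 < q) (hs : s₀ ≠ s₁)
    (hθ₀ : 0 < θ) (hθ₁ : θ < 1) (hp0 : 0 < p) (hp : p⁻¹ = (1 - θ) * p₀⁻¹ + θ * p₁⁻¹)
    (hsθ : s = (1 - θ) * s₀ + θ * s₁) :
    ∃ C : ℝ≥0, ∀ f : L0 (EuclideanSpace ℝ (Fin n)),
      boxSum ε τ p q s f ≤ C * interpNorm (tentNorm p₀ q s₀) (tentNorm p₁ q s₁) θ p f ^ p := by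
  have hn0 : (0 : ℝ) < n := by exact_mod_cast hn
  -- `ex (κ * k)` is the ratio of the two weights at level `k`.
  set κ := -(n * τ * (s₁ - s₀)) with hκ
  have hκ0 : κ ≠ 0 := by
    rw [hκ, neg_ne_zero]
    exact mul_ne_zero (by positivity) (sub_ne_zero.2 hs.symm)
  -- The sampling step of the K-functional, as coarse as the separation `2 * σ ≤ |κ|` allows.
  set σ := |κ| / 2 with hσ
  have hσ0 : 0 < σ := by have := abs_pos.2 hκ0; positivity
  obtain ⟨CB, ε', hε', hbal⟩ := exists_tsum_rpow_le_of_balance (κ := κ) (σ := σ) hp₀ hp₁ hθ₀ hθ₁ hp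
    hσ0 (by rw [hσ]; linarith)
  obtain ⟨CK, hCK⟩ := exists_tsum_le_interpNorm_rpow (A := L0 (EuclideanSpace ℝ (Fin n)))
    hσ0 hθ₀ hp0
  obtain ⟨T₀, hT₀⟩ := exists_lintegral_iSup_le_tentNorm (n := n) hε hεn hτ hq hp₀ s₀
  obtain ⟨T₁, hT₁⟩ := exists_lintegral_iSup_le_tentNorm (n := n) hε hεn hτ hq hp₁ s₁
  obtain ⟨CS, hCS⟩ := exists_tsum_ex_neg_abs_le hε' (α := 1) one_ne_zero
  set D : ℝ≥0∞ := 2 * (2 : ℝ≥0∞) ^ (1 / q) with hD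
  have hDtop : D ≠ ∞ := ENNReal.mul_ne_top (by simp) (by simp)
  have hD0 : D ≠ 0 := by simp [hD]
  set E : ℝ≥0∞ := CB * (D ^ p * 2 ^ p * (CS * (T₀ + T₁))) with hE
  have hEtop : E ≠ ∞ := by
    refine ENNReal.mul_ne_top (by simp) (ENNReal.mul_ne_top (ENNReal.mul_ne_top ?_ ?_) ?_)
    · exact ENNReal.rpow_ne_top_of_nonneg hp0.le hDtop
    · exact ENNReal.rpow_ne_top_of_nonneg hp0.le (by simp)
    · exact ENNReal.mul_ne_top (by simp) (by simp)
  have hEKtop : E * CK + 1 ≠ ∞ := by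
    simpa using ENNReal.mul_ne_top hEtop (by simp)
  -- The added `1` keeps the constant nonzero, so the bound is trivial when the interpolation norm
  -- is infinite.
  refine ⟨(E * CK + 1).toNNReal, fun f => ?_⟩
  rw [ENNReal.coe_toNNReal hEKtop]
  set Φ := interpNorm (tentNorm p₀ q s₀) (tentNorm p₁ q s₁) θ p f ^ p with hΦ
  by_cases hΦtop : Φ = ∞
  · rw [hΦtop, ENNReal.mul_top (by simp)]; exact le_top
  set K : ℤ → ℝ≥0∞ := fun j =>
    KFunctional (tentNorm p₀ q s₀) (tentNorm p₁ q s₁) (Real.exp (σ * j)) f with hK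
  have hKsum : ∑' j : ℤ, (ex (-(θ * (σ * j))) * K j) ^ p ≤ CK * Φ := hCK _ _ f
  have hKtop : ∀ j, K j ≠ ∞ := by
    intro j hj
    have h1 := ENNReal.le_tsum (f := fun j : ℤ => (ex (-(θ * (σ * j))) * K j) ^ p) j
    simp only [hj, ENNReal.mul_top (ex_ne_zero _), ENNReal.top_rpow_of_pos hp0] at h1
    exact ENNReal.mul_ne_top (ENNReal.coe_ne_top (r := CK)) hΦtop (top_le_iff.1 (h1.trans hKsum))
  have main : ∀ η : ℝ≥0∞, η ≠ 0 → boxSum ε τ p q s f ≤ E * (CK * Φ + η) := by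
    intro η hη
    obtain ⟨δ, hδ0, hδ⟩ := ENNReal.exists_pos_sum_of_countable hη ℤ
    -- The infimum need not be attained and may be zero, so each `K j` is enlarged by a positive
    -- error; the `p`-th powers `δ j` of the weighted errors have sum below `η`.
    set d : ℤ → ℝ≥0∞ := fun j => (δ j : ℝ≥0∞) ^ (1 / p) with hd
    have hd0 : ∀ j, d j ≠ 0 := by
      intro j; simp [hd, (hδ0 j).ne']
    have hdtop : ∀ j, d j ≠ ∞ := fun j =>
      ENNReal.rpow_ne_top_of_nonneg (by positivity) ENNReal.coe_ne_top
    set l' : ℤ → ℝ≥0∞ := fun j => ex (-(θ * (σ * j))) * K j + d j with hl'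
    have hl'0 : ∀ j, l' j ≠ 0 := fun j => by simp [hl', hd0 j]
    set K' : ℤ → ℝ≥0∞ := fun j => ex (θ * (σ * j)) * l' j with hK'
    have hK'eq : ∀ j, K' j = K j + ex (θ * (σ * j)) * d j := by
      intro j
      simp only [hK', hl', mul_add]
      rw [← mul_assoc, ex_mul_ex_neg, one_mul]
    have hK'0 : ∀ j, K' j ≠ 0 := fun j => mul_ne_zero (ex_ne_zero _) (hl'0 j)
    have hK'top : ∀ j, K' j ≠ ∞ := fun j => by
      rw [hK'eq]
      exact ENNReal.add_ne_top.2 ⟨hKtop j, ENNReal.mul_ne_top (ex_ne_top _) (hdtop j)⟩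
    have hlt : ∀ j, K j < K' j := fun j => by
      rw [hK'eq]
      exact ENNReal.lt_add_right (hKtop j) (mul_ne_zero (ex_ne_zero _) (hd0 j))
    choose f₀ f₁ hf₀ hf₁ hf hN using fun j => exists_of_KFunctional_lt (hlt j)
    have hN₀ : ∀ j, tentNorm p₀ q s₀ (f₀ j) ≤ K' j := fun j => le_self_add.trans (hN j).le
    have hN₁ : ∀ j : ℤ, tentNorm p₁ q s₁ (f₁ j) ≤ ex (-(σ * j)) * K' j := by
      intro j
      apply le_mul_ex_of_mul_ex_neg_le
      rw [neg_neg]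
      exact le_add_self.trans (hN j).le
    have hK''0 : ∀ j : ℤ, ex (-(σ * j)) * K' j ≠ 0 := fun j => mul_ne_zero (ex_ne_zero _) (hK'0 j)
    have hK''top : ∀ j : ℤ, ex (-(σ * j)) * K' j ≠ ∞ := fun j =>
      ENNReal.mul_ne_top (ex_ne_top _) (hK'top j)
    set A : ℤ → EuclideanSpace ℝ (Fin n) → ℝ≥0∞ := fun j x =>
      ⨆ k : ℤ, ex (-(s₀ * (n * τ)) * k) * boxMean ε τ q (f₀ j) k x with hA
    set B : ℤ → EuclideanSpace ℝ (Fin n) → ℝ≥0∞ := fun j x =>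
      ⨆ k : ℤ, ex (-(s₁ * (n * τ)) * k) * boxMean ε τ q (f₁ j) k x with hB
    have hAm : ∀ j, Measurable (A j) := fun j => Measurable.iSup fun k => by fun_prop
    have hBm : ∀ j, Measurable (B j) := fun j => Measurable.iSup fun k => by fun_prop
    -- Both suprema, normalised by the bounds for their tent quasi-norms and raised to their own
    -- exponents, so that `∫ γ x j` is bounded uniformly in `j`.
    set γ : EuclideanSpace ℝ (Fin n) → ℤ → ℝ≥0∞ := fun x j =>
      (A j x * (K' j)⁻¹) ^ p₀ + (B j x * (ex (-(σ * j)) * K' j)⁻¹) ^ p₁ with hγ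
    have hγm : ∀ j, Measurable (fun x => γ x j) := fun j => by fun_prop
    have hγint : ∀ j, ∫⁻ x, γ x j ≤ T₀ + T₁ := by
      intro j
      simp only [hγ]
      rw [lintegral_add_left (by fun_prop)]
      exact add_le_add
        (lintegral_mul_inv_rpow_le hp₀ (hT₀ (f₀ j)) (hN₀ j) (hK'0 j) (hK'top j))
        (lintegral_mul_inv_rpow_le hp₁ (hT₁ (f₁ j)) (hN₁ j) (hK''0 j) (hK''top j))
    have hpt : ∀ x, ∑' k : ℤ, (ex (-(s * (n * τ)) * k) * boxMean ε τ q f k x) ^ p ≤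
        CB * ∑' j, (D * l' j) ^ p * smoothing ε' (γ x) j := by
      intro x
      refine hbal _ (fun j => D * l' j) (γ x) (fun j => mul_ne_zero hD0 (hl'0 j)) fun k j => ?_
      have e0 : boxMean ε τ q f k x ≤
          D * (boxMean ε τ q (f₀ j) k x + boxMean ε τ q (f₁ j) k x) := by
        have h1 : (f : EuclideanSpace ℝ (Fin n) × ℝ → ℂ) =ᵐ[halfSpaceMeasure _]
            (f₀ j : EuclideanSpace ℝ (Fin n) × ℝ → ℂ) + f₁ j := by
          rw [hf j]; exact AEEqFun.coeFn_add _ _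
        rw [boxMean_congr_ae h1]
        exact boxMean_add_le hq ε τ (f₀ j).stronglyMeasurable.measurable k x
      have e1 : ex (-(s₀ * (n * τ)) * k) * boxMean ε τ q (f₀ j) k x ≤
          K' j * γ x j ^ (1 / p₀) :=
        (le_iSup (fun k : ℤ => ex (-(s₀ * (n * τ)) * k) * boxMean ε τ q (f₀ j) k x) k).trans
          (le_mul_rpow_of_mul_inv_rpow_le hp₀ (hK'0 j) (hK'top j) le_self_add)
      have e2 : ex (-(s₁ * (n * τ)) * k) * boxMean ε τ q (f₁ j) k x ≤
          ex (-(σ * j)) * K' j * γ x j ^ (1 / p₁) :=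
        (le_iSup (fun k : ℤ => ex (-(s₁ * (n * τ)) * k) * boxMean ε τ q (f₁ j) k x) k).trans
          (le_mul_rpow_of_mul_inv_rpow_le hp₁ (hK''0 j) (hK''top j) le_add_self)
      have w0 : ex (-(s * (n * τ)) * k) = ex (θ * (κ * k)) * ex (-(s₀ * (n * τ)) * k) := by
        rw [← ex_add]; congr 1; rw [hκ, hsθ]; ring
      have w1 : ex (-(s * (n * τ)) * k) = ex (-((1 - θ) * (κ * k))) *
          ex (-(s₁ * (n * τ)) * k) := by
        rw [← ex_add]; congr 1; rw [hκ, hsθ]; ring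
      calc ex (-(s * (n * τ)) * k) * boxMean ε τ q f k x
          ≤ ex (-(s * (n * τ)) * k) *
            (D * (boxMean ε τ q (f₀ j) k x + boxMean ε τ q (f₁ j) k x)) := by gcongr
        _ = D * (ex (θ * (κ * k)) * (ex (-(s₀ * (n * τ)) * k) * boxMean ε τ q (f₀ j) k x) +
            ex (-((1 - θ) * (κ * k))) *
              (ex (-(s₁ * (n * τ)) * k) * boxMean ε τ q (f₁ j) k x)) := by
            rw [← mul_assoc (ex (θ * _)), ← w0, ← mul_assoc (ex (-((1 - θ) * _))), ← w1]
            ring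
        _ ≤ D * (ex (θ * (κ * k)) * (K' j * γ x j ^ (1 / p₀)) +
            ex (-((1 - θ) * (κ * k))) *
              (ex (-(σ * j)) * K' j * γ x j ^ (1 / p₁))) := by gcongr
        _ = _ := by
            have v0 : ex (θ * (κ * k + σ * j)) = ex (θ * (κ * k)) * ex (θ * (σ * j)) := by
              rw [← ex_add]; congr 1; ring
            have v1 : ex (-((1 - θ) * (κ * k + σ * j))) =
                ex (-((1 - θ) * (κ * k))) * ex (-(σ * j)) * ex (θ * (σ * j)) := by
              rw [← ex_add, ← ex_add]; congr 1; ring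
            rw [v0, v1]
            simp only [hK']
            ring
    have hsm : ∀ j, Measurable fun x => smoothing ε' (γ x) j := fun j => by
      unfold smoothing
      exact Measurable.tsum fun i => (hγm i).const_mul _
    have hsmint : ∀ j, ∫⁻ x, smoothing ε' (γ x) j ≤ CS * (T₀ + T₁) := by
      intro j
      unfold smoothing
      rw [lintegral_tsum fun i => ((hγm i).const_mul _).aemeasurable]
      calc _ ≤ ∑' i : ℤ, ex (-(ε' * |(i : ℝ) - j|)) * (T₀ + T₁) := by
            gcongr with i
            rw [lintegral_const_mul' _ _ (ex_ne_top _)]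
            gcongr
            exact hγint i
        _ ≤ _ := by
            rw [ENNReal.tsum_mul_right]
            gcongr
            refine le_trans (le_of_eq ?_) (hCS (-j))
            congr 1; ext i; rw [one_mul, sub_eq_add_neg]
    have hlsum : ∑' j, (D * l' j) ^ p ≤ D ^ p * 2 ^ p * (CK * Φ + η) := by
      calc _ ≤ ∑' j : ℤ, D ^ p * 2 ^ p * ((ex (-(θ * (σ * j))) * K j) ^ p + δ j) := by
            refine ENNReal.tsum_le_tsum fun j => ?_
            rw [ENNReal.mul_rpow_of_nonneg _ _ hp0.le, mul_assoc]
            gcongr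
            refine (add_rpow_le_two_mul _ _ hp0).trans (le_of_eq ?_)
            rw [hd, ← ENNReal.rpow_mul, one_div_mul_cancel hp0.ne', ENNReal.rpow_one]
        _ ≤ _ := by
            rw [ENNReal.tsum_mul_left, ENNReal.tsum_add]
            gcongr
    calc boxSum ε τ p q s f
        = ∫⁻ x, ∑' k : ℤ, (ex (-(s * (n * τ)) * k) * boxMean ε τ q f k x) ^ p := by
          rw [boxSum, lintegral_tsum fun k => by fun_prop]
      _ ≤ ∫⁻ x, CB * ∑' j, (D * l' j) ^ p * smoothing ε' (γ x) j := lintegral_mono hpt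
      _ = CB * ∑' j, ∫⁻ x, (D * l' j) ^ p * smoothing ε' (γ x) j := by
          rw [lintegral_const_mul' _ _ ENNReal.coe_ne_top,
            lintegral_tsum fun j => ((hsm j).const_mul _).aemeasurable]
      _ ≤ CB * ∑' j, (D * l' j) ^ p * (CS * (T₀ + T₁)) := by
          gcongr with j
          rw [lintegral_const_mul _ (hsm j)]
          gcongr
          exact hsmint j
      _ ≤ CB * (D ^ p * 2 ^ p * (CK * Φ + η) * (CS * (T₀ + T₁))) := by
          rw [ENNReal.tsum_mul_right]; gcongr
      _ = _ := by rw [hE]; ring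
  refine ENNReal.le_of_forall_pos_le_add fun η hη _ => ?_
  -- The error is rescaled to absorb the factor `E`; dividing by `E + 1` also covers `E = 0`.
  have hη' : (η : ℝ≥0∞) / (E + 1) ≠ 0 := by
    simp [ENNReal.div_eq_zero_iff, hη.ne', hEtop]
  calc boxSum ε τ p q s f ≤ E * (CK * Φ + η / (E + 1)) := main _ hη'
    _ ≤ E * CK * Φ + (E + 1) * (η / (E + 1)) := by
        rw [mul_add, ← mul_assoc E]
        exact add_le_add le_rfl (mul_le_mul' le_self_add le_rfl)
    _ ≤ (E * CK + 1) * Φ + η := by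
        rw [ENNReal.mul_div_cancel (by simp) (by simpa using hEtop)]
        gcongr
        exact le_self_add

/-! ### The Z-space is contained in the interpolation space -/

/-- The union of those boxes whose level and box mean satisfy `Q`. -/
def selectedBoxes (ε τ q : ℝ) (f : EuclideanSpace ℝ (Fin n) × ℝ → ℂ) (Q : ℤ → ℝ≥0∞ → Prop) :
    Set (EuclideanSpace ℝ (Fin n) × ℝ) :=
  ⋃ k, {x | Q k (boxMean ε τ q f k x)} ×ˢ level τ k

theorem measurableSet_selectedBoxes (ε τ q : ℝ) (f : EuclideanSpace ℝ (Fin n) × ℝ → ℂ)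
    {Q : ℤ → ℝ≥0∞ → Prop} (hQ : ∀ k, MeasurableSet {a | Q k a}) :
    MeasurableSet (selectedBoxes ε τ q f Q) :=
  MeasurableSet.iUnion fun k =>
    ((measurable_boxMean ε τ q f k) (hQ k)).prod (measurableSet_level τ k)

theorem mem_selectedBoxes_iff {ε τ q : ℝ} (hτ : 0 < τ) {f : EuclideanSpace ℝ (Fin n) × ℝ → ℂ}
    {Q : ℤ → ℝ≥0∞ → Prop} {k : ℤ} {x : EuclideanSpace ℝ (Fin n)}
    {z : EuclideanSpace ℝ (Fin n) × ℝ} (hz : z ∈ box ε τ k x) :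
    z ∈ selectedBoxes ε τ q f Q ↔ Q k (boxMean ε τ q f k x) := by
  rw [← boxMean_congr_idx hz.1, selectedBoxes, mem_iUnion]
  constructor
  · rintro ⟨l, hl, hl'⟩
    have : l = k := by
      by_contra hne
      exact (pairwise_disjoint_level hτ hne).le_bot ⟨hl', hz.2⟩
    subst this
    exact hl
  · exact fun h => ⟨k, h, hz.2⟩

theorem boxMean_indicator_selectedBoxes {ε τ q : ℝ} (hτ : 0 < τ) (hq : 0 < q)
    (f : EuclideanSpace ℝ (Fin n) × ℝ → ℂ) (Q : ℤ → ℝ≥0∞ → Prop) (k : ℤ)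
    (x : EuclideanSpace ℝ (Fin n)) :
    boxMean ε τ q ((selectedBoxes ε τ q f Q).indicator f) k x =
      {k | Q k (boxMean ε τ q f k x)}.indicator (fun k => boxMean ε τ q f k x) k := by
  by_cases h : Q k (boxMean ε τ q f k x)
  · rw [indicator_of_mem (by exact h)]
    exact boxMean_congr_on fun z hz => indicator_of_mem ((mem_selectedBoxes_iff hτ hz).2 h) _
  · rw [indicator_of_notMem (by exact h), ← boxMean_zero hq k x]
    exact boxMean_congr_on fun z hz =>
      indicator_of_notMem (fun h' => h ((mem_selectedBoxes_iff hτ hz).1 h')) _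

theorem boxMean_indicator_compl_selectedBoxes {ε τ q : ℝ} (hτ : 0 < τ) (hq : 0 < q)
    (f : EuclideanSpace ℝ (Fin n) × ℝ → ℂ) (Q : ℤ → ℝ≥0∞ → Prop) (k : ℤ)
    (x : EuclideanSpace ℝ (Fin n)) :
    boxMean ε τ q ((selectedBoxes ε τ q f Q)ᶜ.indicator f) k x =
      {k | ¬ Q k (boxMean ε τ q f k x)}.indicator (fun k => boxMean ε τ q f k x) k := by
  by_cases h : Q k (boxMean ε τ q f k x)
  · rw [indicator_of_notMem (by simpa using h), ← boxMean_zero hq k x]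
    exact boxMean_congr_on fun z hz =>
      indicator_of_notMem (by simpa using (mem_selectedBoxes_iff hτ hz).2 h) _
  · rw [indicator_of_mem (by exact h)]
    exact boxMean_congr_on fun z hz =>
      indicator_of_mem (mem_compl fun h' => h ((mem_selectedBoxes_iff hτ hz).1 h')) _

theorem measurableSet_belowThreshold (P P' κ₀ κ₁ υ : ℝ) (k : ℤ) :
    MeasurableSet {a | BelowThreshold P P' κ₀ κ₁ υ k a} := by
  unfold BelowThreshold
  exact measurableSet_le (by fun_prop) (by fun_prop)

/-- The threshold condition reads box means through `toReal`, so the sequence bounds apply only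
where these means are finite. -/
theorem ae_boxMean_ne_top {ε τ p q s : ℝ} (hp : 0 < p)
    {f : EuclideanSpace ℝ (Fin n) × ℝ → ℂ} (hf : boxSum ε τ p q s f ≠ ∞) (k : ℤ)
    (v : EuclideanSpace ℝ (Fin n)) : ∀ᵐ x, boxMean ε τ q f k (x + v) ≠ ∞ := by
  have h1 := ENNReal.ne_top_of_tsum_ne_top hf k
  rw [← lintegral_add_right_eq_self _ v] at h1
  filter_upwards [ae_lt_top (by fun_prop) h1] with x hx
  intro h
  rw [h, ENNReal.mul_top (ex_ne_zero _), ENNReal.top_rpow_of_pos hp] at hx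
  exact lt_irrefl _ hx

/-- A bound for cut-off sequences passes to the tent quasi-norms of the functions obtained by the
corresponding selection of boxes. -/
theorem exists_tsum_tentNorm_le {ε τ P p q s s' : ℝ} (hε : 0 < ε) (hτ : 0 < τ) (hq : 0 < q)
    (hP : 0 < P) (hp : 0 < p) (w : ℤ → ℝ≥0∞) (Q : ℤ → ℤ → ℝ≥0∞ → Prop) {C : ℝ≥0}
    (hC : ∀ a : ℤ → ℝ≥0∞, (∀ k, a k ≠ ∞) →
      ∑' i : ℤ, w i * (∑' k : ℤ, {k | Q i k (a k)}.indicator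
        (fun k => (ex (-(s * (n * τ)) * k) * a k) ^ q) k) ^ (P / q) ≤
      C * ∑' k : ℤ, (ex (-(s' * (n * τ)) * k) * a k) ^ p) :
    ∃ C' : ℝ≥0, ∀ f : EuclideanSpace ℝ (Fin n) × ℝ → ℂ, boxSum ε τ p q s' f ≠ ∞ →
      ∀ g : ℤ → L0 (EuclideanSpace ℝ (Fin n)),
      (∀ i k x, boxMean ε τ q (g i) k x =
        {k | Q i k (boxMean ε τ q f k x)}.indicator (fun k => boxMean ε τ q f k x) k) →
      ∑' i : ℤ, w i * tentNorm P q s (g i) ^ P ≤ C' * boxSum ε τ p q s' f := by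
  obtain ⟨T, R, hT⟩ := exists_tentNorm_rpow_le (n := n) hε hτ hq hP s
  refine ⟨T * ((offsets n R).card * C), fun f hf g hg => ?_⟩
  set v : (Fin n → ℤ) → ℤ → EuclideanSpace ℝ (Fin n) :=
    fun j k => latticeVec (ε * Real.exp (τ * k)) j with hv
  have hone : ∀ j, ∑' i : ℤ, w i * ∫⁻ x, (∑' k : ℤ, (ex (-(s * (n * τ)) * k) *
      boxMean ε τ q (g i) k (x + v j k)) ^ q) ^ (P / q) ≤ C * boxSum ε τ p q s' f := by
    intro j
    calc _ = ∫⁻ x, ∑' i : ℤ, w i * (∑' k : ℤ, (ex (-(s * (n * τ)) * k) *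
          boxMean ε τ q (g i) k (x + v j k)) ^ q) ^ (P / q) := by
          rw [lintegral_tsum fun i => by fun_prop]
          refine tsum_congr fun i => ?_
          rw [lintegral_const_mul _ (by fun_prop)]
      _ ≤ ∫⁻ x, C * ∑' k : ℤ, (ex (-(s' * (n * τ)) * k) *
          boxMean ε τ q f k (x + v j k)) ^ p := by
          refine lintegral_mono_ae ?_
          -- The sequence bound is applied to the means along the points `x + v j k`. The
          -- translation depends on the scale, but on the right each scale is integrated separately,
          -- so translation invariance removes it.
          filter_upwards [ae_all_iff.2 fun k => ae_boxMean_ne_top hp hf k (v j k)] with x hx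
          refine le_trans (le_of_eq ?_) (hC (fun k => boxMean ε τ q f k (x + v j k)) hx)
          refine tsum_congr fun i => ?_
          congr 2
          refine tsum_congr fun k => ?_
          rw [hg]
          by_cases h : Q i k (boxMean ε τ q f k (x + v j k))
          · rw [indicator_of_mem (by exact h), indicator_of_mem (by exact h)]
          · rw [indicator_of_notMem (by exact h), indicator_of_notMem (by exact h), mul_zero,
              ENNReal.zero_rpow_of_pos hq]
      _ = _ := by
          rw [lintegral_const_mul' _ _ ENNReal.coe_ne_top, lintegral_tsum fun k => by fun_prop,
            boxSum]
          congr 1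
          refine tsum_congr fun k => ?_
          exact lintegral_add_right_eq_self
            (fun x => (ex (-(s' * (n * τ)) * k) * boxMean ε τ q f k x) ^ p) (v j k)
  calc _ ≤ ∑' i : ℤ, w i * (T * ∑ j ∈ offsets n R, ∫⁻ x, (∑' k : ℤ, (ex (-(s * (n * τ)) * k) *
      boxMean ε τ q (g i) k (x + v j k)) ^ q) ^ (P / q)) := by
        gcongr; exact hT _
    _ = T * ∑ j ∈ offsets n R, ∑' i : ℤ, w i * ∫⁻ x, (∑' k : ℤ, (ex (-(s * (n * τ)) * k) *
      boxMean ε τ q (g i) k (x + v j k)) ^ q) ^ (P / q) := by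
        rw [← Summable.tsum_finsetSum (fun _ _ => ENNReal.summable), ← ENNReal.tsum_mul_left]
        refine tsum_congr fun i => ?_
        rw [mul_left_comm, Finset.mul_sum]
    _ ≤ T * ∑ j ∈ offsets n R, C * boxSum ε τ p q s' f := by
        gcongr with j; exact hone j
    _ = _ := by
        rw [Finset.sum_const, nsmul_eq_mul]
        push_cast
        ring

theorem exists_interpNorm_le_boxSum {ε τ p₀ p₁ q s₀ s₁ θ p s : ℝ} (hn : 1 ≤ n) (hε : 0 < ε)
    (hτ : 0 < τ) (hp₀ : 0 < p₀) (hp₁ : 0 < p₁) (hq : 0 < q) (hs : s₀ ≠ s₁)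
    (hθ₀ : 0 < θ) (hθ₁ : θ < 1) (hp0 : 0 < p) (hp : p⁻¹ = (1 - θ) * p₀⁻¹ + θ * p₁⁻¹)
    (hsθ : s = (1 - θ) * s₀ + θ * s₁) :
    ∃ C : ℝ≥0, ∀ f : L0 (EuclideanSpace ℝ (Fin n)),
      interpNorm (tentNorm p₀ q s₀) (tentNorm p₁ q s₁) θ p f ^ p ≤ C * boxSum ε τ p q s f := by
  have hn0 : (0 : ℝ) < n := by exact_mod_cast hn
  -- This `η` makes `p₀ (1 - η) = p (1 - θ)` and `p₁ η = p θ`, the exponent relations required by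
  -- the cut-off bounds.
  set η := p * θ / p₁ with hη
  have hη0 : 0 < η := by positivity
  have h1η : 1 - η = p * (1 - θ) / p₀ := by
    have : p * p⁻¹ = 1 := mul_inv_cancel₀ hp0.ne'
    rw [hp] at this
    rw [hη, div_eq_mul_inv, div_eq_mul_inv]
    linarith
  have hη1 : η < 1 := by
    have : 0 < p * (1 - θ) / p₀ := div_pos (mul_pos hp0 (sub_pos.2 hθ₁)) hp₀
    linarith
  have hP₀ : p₀ * (1 - η) = p * (1 - θ) := by rw [h1η]; field_simp
  have hP₁ : p₁ * η = p * θ := by rw [hη]; field_simp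
  set κ₀ := -(s₀ * (n * τ)) with hκ₀
  set κ₁ := -(s₁ * (n * τ)) with hκ₁
  have hκ : κ₀ ≠ κ₁ := by
    rw [hκ₀, hκ₁, Ne, neg_inj]
    exact fun h => hs (mul_right_cancel₀ (by positivity) h)
  have hκs : (1 - θ) * κ₀ + θ * κ₁ = -(s * (n * τ)) := by rw [hκ₀, hκ₁, hsθ]; ring
  obtain ⟨C₀, hC₀⟩ := exists_tsum_belowThreshold_le (σ := 1) (q := q) hp₀ hp₁ hq hη0 one_pos hκ
    hP₀ hP₁
  obtain ⟨C₁, hC₁⟩ := exists_tsum_not_belowThreshold_le (σ := 1) (q := q) hp₀ hp₁ hq hη1 one_pos hκ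
    hP₀ hP₁
  rw [hκs] at hC₀ hC₁
  obtain ⟨D₀, hD₀⟩ := exists_tsum_tentNorm_le (n := n) (s := s₀) (s' := s) hε hτ hq hp₀ hp0 _
    (fun i k a => BelowThreshold p₀ p₁ κ₀ κ₁ (1 * i) k a) hC₀
  obtain ⟨D₁, hD₁⟩ := exists_tsum_tentNorm_le (n := n) (s := s₁) (s' := s) hε hτ hq hp₁ hp0 _
    (fun i k a => ¬ BelowThreshold p₀ p₁ κ₀ κ₁ (1 * i) k a) hC₁
  -- Chosen so that `θ σ p₀ = η` and `(1 - θ) σ p₁ = 1 - η`: the weights in `M₀` and `M₁` then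
  -- become those of the balancing lemma after taking roots.
  set σ := p / (p₀ * p₁) with hσ
  have hσ0 : 0 < σ := by positivity
  obtain ⟨CB, ε', hε', hbal⟩ := exists_tsum_rpow_le_of_balance (κ := -(2 * σ)) (σ := σ)
    hp₀ hp₁ hθ₀ hθ₁ hp hσ0 (by rw [abs_neg, abs_of_pos (by positivity)])
  obtain ⟨CK, hCK⟩ := exists_interpNorm_rpow_le_tsum (A := L0 (EuclideanSpace ℝ (Fin n)))
    (κ := 2 * σ) (by positivity) hθ₀ hp0
  obtain ⟨CS, hCS⟩ := exists_tsum_smoothing_le hε'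
  refine ⟨CK * (CB * (CS * (D₀ + D₁))) + 1, fun f => ?_⟩
  by_cases hf : boxSum ε τ p q s f = ∞
  · rw [hf, ENNReal.mul_top (by simp)]; exact le_top
  set S : ℤ → Set (EuclideanSpace ℝ (Fin n) × ℝ) := fun i =>
    selectedBoxes ε τ q f fun k a => BelowThreshold p₀ p₁ κ₀ κ₁ (1 * i) k a with hS
  have hSm : ∀ i, MeasurableSet (S i) := fun i =>
    measurableSet_selectedBoxes _ _ _ _ fun k => measurableSet_belowThreshold _ _ _ _ _ k
  set f₀ : ℤ → L0 (EuclideanSpace ℝ (Fin n)) := fun i =>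
    AEEqFun.mk ((S i).indicator f)
      (f.stronglyMeasurable.indicator (hSm i)).aestronglyMeasurable with hf₀
  set f₁ : ℤ → L0 (EuclideanSpace ℝ (Fin n)) := fun i =>
    AEEqFun.mk ((S i)ᶜ.indicator f)
      (f.stronglyMeasurable.indicator (hSm i).compl).aestronglyMeasurable with hf₁
  have hadd : ∀ i, f = f₀ i + f₁ i := by
    intro i
    apply AEEqFun.ext
    filter_upwards [AEEqFun.coeFn_add (f₀ i) (f₁ i),
      AEEqFun.coeFn_mk _ (f.stronglyMeasurable.indicator (hSm i)).aestronglyMeasurable,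
      AEEqFun.coeFn_mk _ (f.stronglyMeasurable.indicator (hSm i).compl).aestronglyMeasurable]
      with z h1 h2 h3
    rw [h1, Pi.add_apply, h2, h3, ← Pi.add_apply, indicator_self_add_compl]
  have hM₀ := hD₀ f hf f₀ fun i k x => by
    rw [boxMean_congr_ae (AEEqFun.coeFn_mk _ _)]
    exact boxMean_indicator_selectedBoxes hτ hq f _ k x
  have hM₁ := hD₁ f hf f₁ fun i k x => by
    rw [boxMean_congr_ae (AEEqFun.coeFn_mk _ _)]
    exact boxMean_indicator_compl_selectedBoxes hτ hq f _ k x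
  set M₀ : ℤ → ℝ≥0∞ := fun i => ex (-(η * (1 * i))) * tentNorm p₀ q s₀ (f₀ i) ^ p₀ with hM₀def
  set M₁ : ℤ → ℝ≥0∞ := fun i => ex ((1 - η) * (1 * i)) * tentNorm p₁ q s₁ (f₁ i) ^ p₁ with hM₁def
  have hN₀ : ∀ i : ℤ, tentNorm p₀ q s₀ (f₀ i) ≤
      ex (θ * (σ * i)) * (M₀ i + M₁ i) ^ (1 / p₀) := by
    intro i
    rw [← ENNReal.rpow_le_rpow_iff hp₀, ENNReal.mul_rpow_of_nonneg _ _ hp₀.le, ← ENNReal.rpow_mul,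
      one_div_mul_cancel hp₀.ne', ENNReal.rpow_one, ex_rpow]
    have e : θ * (σ * i) * p₀ = η * (1 * i) := by rw [hσ, hη]; field_simp
    rw [e]
    exact le_mul_ex_of_mul_ex_neg_le le_self_add
  have hN₁ : ∀ i : ℤ, tentNorm p₁ q s₁ (f₁ i) ≤
      ex (-((1 - θ) * (σ * i))) * (M₀ i + M₁ i) ^ (1 / p₁) := by
    intro i
    rw [← ENNReal.rpow_le_rpow_iff hp₁, ENNReal.mul_rpow_of_nonneg _ _ hp₁.le, ← ENNReal.rpow_mul,
      one_div_mul_cancel hp₁.ne', ENNReal.rpow_one, ex_rpow]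
    have e : -((1 - θ) * (σ * i)) * p₁ = -((1 - η) * (1 * i)) := by rw [hσ, h1η]; field_simp
    rw [e]
    apply le_mul_ex_of_mul_ex_neg_le
    rw [neg_neg]
    exact le_add_self
  have hMsum : ∑' i, (M₀ i + M₁ i) ≤ (D₀ + D₁) * boxSum ε τ p q s f := by
    rw [ENNReal.tsum_add, add_mul]
    exact add_le_add hM₀ hM₁
  have hMtop : ∀ i, M₀ i + M₁ i ≠ ∞ := fun i =>
    ENNReal.ne_top_of_tsum_ne_top
      (ne_top_of_le_ne_top (ENNReal.mul_ne_top (by simp) hf) hMsum) i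
  have hfin₀ : ∀ i, tentNorm p₀ q s₀ (f₀ i) < ∞ := fun i => (hN₀ i).trans_lt
    (ENNReal.mul_lt_top (ex_ne_top _).lt_top
      (ENNReal.rpow_ne_top_of_nonneg (by positivity) (hMtop i)).lt_top)
  have hfin₁ : ∀ i, tentNorm p₁ q s₁ (f₁ i) < ∞ := fun i => (hN₁ i).trans_lt
    (ENNReal.mul_lt_top (ex_ne_top _).lt_top
      (ENNReal.rpow_ne_top_of_nonneg (by positivity) (hMtop i)).lt_top)
  -- Here `k` indexes samples of the K-functional at `e^{2σk}` and `i` the admissible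
  -- decompositions. The sampling step `2 * σ` is what gives `|κ| = 2 * σ` in the balancing lemma.
  have hfinal := hbal (fun k => ex (-(θ * (2 * σ * k))) *
    KFunctional (tentNorm p₀ q s₀) (tentNorm p₁ q s₁) (Real.exp (2 * σ * k)) f)
    (fun _ => 1) (fun i => M₀ i + M₁ i) (fun _ => one_ne_zero) fun k i => by
      have e1 : ex (θ * (-(2 * σ) * k + σ * i)) = ex (-(θ * (2 * σ * k))) * ex (θ * (σ * i)) := by
        rw [← ex_add]; congr 1; ring
      have e2 : ex (-((1 - θ) * (-(2 * σ) * k + σ * i))) =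
          ex (-(θ * (2 * σ * k))) * (ex (2 * σ * k) * ex (-((1 - θ) * (σ * i)))) := by
        rw [← ex_add, ← ex_add]; congr 1; ring
      calc _ ≤ ex (-(θ * (2 * σ * k))) * (ex (θ * (σ * i)) * (M₀ i + M₁ i) ^ (1 / p₀) +
            ex (2 * σ * k) * (ex (-((1 - θ) * (σ * i))) * (M₀ i + M₁ i) ^ (1 / p₁))) := by
            refine mul_le_mul' le_rfl ((KFunctional_le _ (hfin₀ i) (hfin₁ i) (hadd i)).trans ?_)
            exact add_le_add (hN₀ i) (mul_le_mul' le_rfl (hN₁ i))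
        _ = _ := by rw [one_mul, e1, e2]; ring
  simp only [ENNReal.one_rpow, one_mul] at hfinal
  calc _ ≤ CK * ∑' k : ℤ, (ex (-(θ * (2 * σ * k))) *
        KFunctional (tentNorm p₀ q s₀) (tentNorm p₁ q s₁) (Real.exp (2 * σ * k)) f) ^ p :=
        hCK _ _ f
    _ ≤ CK * (CB * (CS * ((D₀ + D₁) * boxSum ε τ p q s f))) := by
        refine mul_le_mul' le_rfl (hfinal.trans (mul_le_mul' le_rfl ((hCS _).trans ?_)))
        exact mul_le_mul' le_rfl hMsum
    _ = (CK * (CB * (CS * (D₀ + D₁)))) * boxSum ε τ p q s f := by ring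
    _ ≤ _ := by
        push_cast
        exact mul_le_mul' le_self_add le_rfl

/-! ### Equality of the spaces and the equivalence of quasi-norms. -/

theorem interpSpace_eq_finiteSpace {A : Type*} [AddCommGroup A] {N₀ N₁ : A → ℝ≥0∞}
    {θ r : ℝ} (hr : 0 < r) :
    interpSpace N₀ N₁ θ r = finiteSpace (interpNorm N₀ N₁ θ r) := by
  ext a
  refine ⟨fun h => h.2, fun h => ⟨?_, h⟩⟩
  by_contra hna
  -- Outside the sum space the infimum is over an empty set for every `t`, so the integral is
  -- already infinite over one level of positive measure.
  have hK : ∀ t, KFunctional N₀ N₁ t a = ∞ := by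
    intro t
    by_contra ht
    obtain ⟨a₀, a₁, h₀, h₁, h2, -⟩ := exists_of_KFunctional_lt (lt_top_iff_ne_top.2 ht)
    exact hna ⟨a₀, h₀, a₁, h₁, h2⟩
  have h3 : interpNorm N₀ N₁ θ r a ^ r < ∞ :=
    ENNReal.rpow_lt_top_of_nonneg hr.le (ne_of_lt h)
  have h4 : dtOverT (level 1 0) ≠ 0 := by
    refine ((ENNReal.ofReal_pos.2 ?_).trans_le (le_dtOverT_level 1 0)).ne'
    rw [sub_pos, Real.exp_lt_one_iff]; norm_num
  rw [interpNorm_rpow hr] at h3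
  have h5 : ∫⁻ t in level 1 0, (∞ : ℝ≥0∞) ∂dtOverT ≤
      ∫⁻ t, (ENNReal.ofReal (t ^ (-θ)) * KFunctional N₀ N₁ t a) ^ r ∂dtOverT := by
    refine le_trans ?_ (setLIntegral_le_lintegral (level 1 0) _)
    refine setLIntegral_mono' (measurableSet_level 1 0) fun t ht => ?_
    have ht0 : 0 < t := level_subset_Ioi _ _ ht
    rw [hK, ENNReal.mul_top (ENNReal.ofReal_pos.2 (Real.rpow_pos_of_pos ht0 _)).ne',
      ENNReal.top_rpow_of_pos hr]
  rw [setLIntegral_const, ENNReal.top_mul h4] at h5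
  exact (h5.trans_lt h3).ne rfl

theorem le_rpow_inv_mul_of_rpow_le {a b : ℝ≥0∞} {C : ℝ≥0} {p : ℝ} (hp : 0 < p)
    (h : a ^ p ≤ C * b ^ p) : a ≤ (C ^ (1 / p) : ℝ≥0) * b := by
  rw [← ENNReal.rpow_le_rpow_iff hp, ENNReal.mul_rpow_of_nonneg _ _ hp.le,
    ← ENNReal.coe_rpow_of_nonneg _ hp.le, ← NNReal.rpow_mul, one_div_mul_cancel hp.ne',
    NNReal.rpow_one]
  exact h

end TentSpaces

theorem mainTheorem2 (n : ℕ) (hn : 1 ≤ n)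
    (p₀ p₁ q s₀ s₁ θ pθ sθ c₀ c₁ : ℝ)
    (hp₀ : 0 < p₀) (hp₁ : 0 < p₁) (hq : 1 ≤ q) (hs : s₀ ≠ s₁)
    (hθ₀ : 0 < θ) (hθ₁ : θ < 1)
    (hpθ : pθ⁻¹ = (1 - θ) * p₀⁻¹ + θ * p₁⁻¹)
    (hsθ : sθ = (1 - θ) * s₀ + θ * s₁)
    (hc₀ : 0 < c₀) (hc₁ : 1 < c₁) :
    TentSpaces.interpSpace
        (TentSpaces.tentNorm (X := EuclideanSpace ℝ (Fin n)) p₀ q s₀)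
        (TentSpaces.tentNorm (X := EuclideanSpace ℝ (Fin n)) p₁ q s₁) θ pθ
      = TentSpaces.zSpace (EuclideanSpace ℝ (Fin n)) pθ q sθ c₀ c₁ ∧
    ∃ C : ℝ≥0, ∀ f : TentSpaces.L0 (EuclideanSpace ℝ (Fin n)),
      TentSpaces.interpNorm (TentSpaces.tentNorm p₀ q s₀) (TentSpaces.tentNorm p₁ q s₁) θ pθ f
          ≤ C * TentSpaces.zNorm pθ q sθ c₀ c₁ f ∧
      TentSpaces.zNorm pθ q sθ c₀ c₁ f
          ≤ C * TentSpaces.interpNorm (TentSpaces.tentNorm p₀ q s₀)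
              (TentSpaces.tentNorm p₁ q s₁) θ pθ f := by
  open TentSpaces in
  have hq0 : 0 < q := one_pos.trans_le hq
  have hp0 : 0 < pθ := by
    rw [← inv_pos, hpθ]
    exact add_pos (mul_pos (sub_pos.2 hθ₁) (inv_pos.2 hp₀)) (mul_pos hθ₀ (inv_pos.2 hp₁))
  have hn0 : (0 : ℝ) < n := by exact_mod_cast hn
  -- One grid for both comparisons: `n * ε` lies below the aperture `1` of the cones and below `c₀`,
  -- while `τ = log c₁` makes each level fit into the Whitney regions.
  set ε := min c₀ 1 / (2 * n) with hε
  have hm : 0 < min c₀ 1 := lt_min hc₀ one_pos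
  have hε0 : 0 < ε := by positivity
  have hnε : n * ε < min c₀ 1 := by
    have : n * ε = min c₀ 1 / 2 := by rw [hε]; field_simp
    linarith
  have hnε₀ : n * ε < c₀ := hnε.trans_le (min_le_left _ _)
  have hnε₁ : n * ε < 1 := hnε.trans_le (min_le_right _ _)
  have hτ0 : 0 < Real.log c₁ := Real.log_pos hc₁
  have hτ : Real.exp (Real.log c₁) ≤ c₁ := (Real.exp_log (one_pos.trans hc₁)).le
  obtain ⟨A₁, hA₁⟩ := exists_interpNorm_le_boxSum hn hε0 hτ0 hp₀ hp₁ hq0 hs hθ₀ hθ₁ hp0 hpθ hsθ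
  obtain ⟨A₂, hA₂⟩ := exists_boxSum_le_zNorm hε0 hnε₀ hτ0 hτ hc₀ hc₁ hq0 hp0 sθ
  obtain ⟨B₁, hB₁⟩ := exists_zNorm_rpow_le_boxSum (n := n) hε0 hτ0 hc₀ hc₁ hq0 hp0 sθ
  obtain ⟨B₂, hB₂⟩ := exists_boxSum_le_interpNorm hn hε0 hnε₁ hτ0 hp₀ hp₁ hq0 hs hθ₀ hθ₁ hp0
    hpθ hsθ
  have hA : ∀ f : L0 (EuclideanSpace ℝ (Fin n)),
      interpNorm (tentNorm p₀ q s₀) (tentNorm p₁ q s₁) θ pθ f ≤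
        ((A₁ * A₂) ^ (1 / pθ) : ℝ≥0) * zNorm pθ q sθ c₀ c₁ f := fun f =>
    le_rpow_inv_mul_of_rpow_le hp0 ((hA₁ f).trans (by
      rw [ENNReal.coe_mul, mul_assoc]; exact mul_le_mul' le_rfl (hA₂ f)))
  have hB : ∀ f : L0 (EuclideanSpace ℝ (Fin n)), zNorm pθ q sθ c₀ c₁ f ≤
      ((B₁ * B₂) ^ (1 / pθ) : ℝ≥0) *
        interpNorm (tentNorm p₀ q s₀) (tentNorm p₁ q s₁) θ pθ f := fun f =>
    le_rpow_inv_mul_of_rpow_le hp0 ((hB₁ f).trans (by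
      rw [ENNReal.coe_mul, mul_assoc]; exact mul_le_mul' le_rfl (hB₂ f)))
  refine ⟨?_, max ((A₁ * A₂) ^ (1 / pθ)) ((B₁ * B₂) ^ (1 / pθ)), fun f => ⟨?_, ?_⟩⟩
  · rw [interpSpace_eq_finiteSpace hp0, zSpace]
    ext f
    exact ⟨fun h => (hB f).trans_lt (ENNReal.mul_lt_top ENNReal.coe_lt_top h),
      fun h => (hA f).trans_lt (ENNReal.mul_lt_top ENNReal.coe_lt_top h)⟩
  · exact (hA f).trans (mul_le_mul' (by exact_mod_cast le_max_left _ _) le_rfl)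
  · exact (hB f).trans (mul_le_mul' (by exact_mod_cast le_max_right _ _) le_rfl)
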